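/- Let $m,l,r\in\mathbb N$ and let $q\in[1,\infty]$, $p\in[1,\infty]$ with $1/p+1/q=1$. Let $W$ be a random vector in $\mathbb{R}^m$ that has a density with respect to Lebesgue measure which is positive almost everywhere, and let $W_1,W_2,\dots$ be i.i.d. copies of $W$. Let $h:\mathbb{R}^m\times\mathbb{R}^l\to\mathbb{R}^r$ and $\theta_*\in\mathbb{R}^l$ be such that - $E[h(W,\theta_*)]=0$ and $E\|h(W,\theta_*)\|_2^2<\infty$; - $h(\cdot,\theta_*)$ is continuously differentiable, with Jacobian $D_wh(\cdot,\theta_*)$; - $P\big(\|\zeta^TD_wh(W,\theta_*)\|_p>0\big)>0$ for every $\zeta\in\mathbb{R}^r\setminus\{0\}$. For probability measures $P,Q$ on $\mathbb{R}^m$ let $\mathcal D(P,Q)=\inf_\pi E_\pi\|U-V\|_q$, the infimum being over all probability measures $\pi$ on $\mathbb{R}^m\times\mathbb{R}^m$, the law of $(U,V)$, with marginals $P$ and $Q$. With $P_n=\frac1n\sum_{i=1}^n\delta_{W_i}$, let $$R_n(\theta_*;1)=\inf\big\{\mathcal D(P,P_n):\ P\text{ a probability measure on }\mathbb{R}^m,\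 h(\cdot,\theta_*)\in L^1(P),\ E_P[h(\cdot,\theta_*)]=0\big\}.$$ Let $H\sim\mathcal N\big(0,\,E[h(W,\theta_*)h(W,\theta_*)^T]\big)$ in $\mathbb{R}^r$ and let $$\bar R(1)=\max\big\{\zeta^TH:\ \zeta\in\mathbb{R}^r,\ P\big(\|\zeta^TD_wh(W,\theta_*)\|_p>1\big)=0\big\}.$$ Then $R_n(\theta_*;1)<\infty$ for every $n\ge1$, the maximum defining $\bar R(1)$ is attained for every value of $H$, and, as $n\to\infty$, $$\sqrt n\,R_n(\theta_*;1)\Rightarrow\bar R(1)\quad\text{in distribution.}$$ -/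

import Mathlib

open MeasureTheory ProbabilityTheory Filter
open scoped ENNReal

noncomputable section

namespace RWP

/-- The `ℓ_q` norm `‖v‖_q` of a vector `v ∈ ℝᵏ`, for `q ∈ [1, ∞]`. -/
def lqNorm (q : ℝ≥0∞) {k : ℕ} (v : EuclideanSpace ℝ (Fin k)) : ℝ :=
  ‖WithLp.toLp q (WithLp.ofLp v)‖

/-- The cost function `c(u, w) = ‖u - w‖_q ^ ρ`. -/
def cost (q : ℝ≥0∞) (ρ : ℝ) {m : ℕ} (u w : EuclideanSpace ℝ (Fin m)) : ℝ≥0∞ :=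
  ENNReal.ofReal (lqNorm q (u - w) ^ ρ)

/-- The optimal transport cost `D_c(P, Q)`: the infimum of `E_π[c(U, W)]` over all probability
measures `π` on `ℝᵐ × ℝᵐ` with first marginal `P` and second marginal `Q`. -/
def transportCost {m : ℕ} (c : EuclideanSpace ℝ (Fin m) → EuclideanSpace ℝ (Fin m) → ℝ≥0∞)
    (P Q : Measure (EuclideanSpace ℝ (Fin m))) : ℝ≥0∞ :=
  ⨅ (π : Measure (EuclideanSpace ℝ (Fin m) × EuclideanSpace ℝ (Fin m)))
    (_ : IsProbabilityMeasure π ∧ π.map Prod.fst = P ∧ π.map Prod.snd = Q),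
    ∫⁻ z, c z.1 z.2 ∂π

/-- The empirical distribution `P_n = n⁻¹ ∑ᵢ δ_{wᵢ}` of the points `w₀, …, w_{n-1}`. -/
def empiricalMeasure {m : ℕ} (n : ℕ) (w : ℕ → EuclideanSpace ℝ (Fin m)) :
    Measure (EuclideanSpace ℝ (Fin m)) :=
  (n : ℝ≥0∞)⁻¹ • ∑ i ∈ Finset.range n, Measure.dirac (w i)

/-- The robust Wasserstein profile function `R_n(θ; ρ) = inf {D_c(P, P_n) : E_P[h(W, θ)] = 0}` of
the sample points `w₀, …, w_{n-1}`, for the cost `c(u, w) = ‖u - w‖_q ^ ρ`; the infimum is over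
probability measures `P` on `ℝᵐ` for which `h(·, θ)` is integrable with mean zero. -/
def profile {m l r : ℕ} (q : ℝ≥0∞) (ρ : ℝ)
    (h : EuclideanSpace ℝ (Fin m) → EuclideanSpace ℝ (Fin l) → EuclideanSpace ℝ (Fin r))
    (n : ℕ) (w : ℕ → EuclideanSpace ℝ (Fin m)) (θ : EuclideanSpace ℝ (Fin l)) : ℝ≥0∞ :=
  ⨅ (P : Measure (EuclideanSpace ℝ (Fin m)))
    (_ : IsProbabilityMeasure P ∧ Integrable (fun u => h u θ) P ∧ ∫ u, h u θ ∂P = 0),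
    transportCost (cost q ρ) P (empiricalMeasure n w)

/-- The row vector `ζᵀ D_w h(w, θ) ∈ ℝᵐ`, with entries `∑ᵢ ζᵢ ∂hᵢ/∂wⱼ (w, θ)`. -/
def rowDeriv {m l r : ℕ}
    (h : EuclideanSpace ℝ (Fin m) → EuclideanSpace ℝ (Fin l) → EuclideanSpace ℝ (Fin r))
    (θ : EuclideanSpace ℝ (Fin l)) (ζ : EuclideanSpace ℝ (Fin r))
    (w : EuclideanSpace ℝ (Fin m)) : EuclideanSpace ℝ (Fin m) :=
  WithLp.toLp 2 fun j =>
    inner ℝ ζ (fderiv ℝ (fun u => h u θ) w (EuclideanSpace.single j (1 : ℝ)))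

/-- The set of `ζ ∈ ℝʳ` with `P(‖ζᵀ D_w h(W, θ)‖_p > 1) = 0`. -/
def dualSet {m l r : ℕ} {Ω : Type*} [MeasurableSpace Ω] (μ : Measure Ω) (p : ℝ≥0∞)
    (h : EuclideanSpace ℝ (Fin m) → EuclideanSpace ℝ (Fin l) → EuclideanSpace ℝ (Fin r))
    (θ : EuclideanSpace ℝ (Fin l)) (W : Ω → EuclideanSpace ℝ (Fin m)) :
    Set (EuclideanSpace ℝ (Fin r)) :=
  {ζ | μ {ω | 1 < lqNorm p (rowDeriv h θ ζ (W ω))} = 0}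

/-- `sup_{ζ ∈ A} ζᵀ x`. The limit variable `R̄(1)` is its value at `x = H`, `A = dualSet …`. -/
def supLinear {r : ℕ} (A : Set (EuclideanSpace ℝ (Fin r))) (x : EuclideanSpace ℝ (Fin r)) : ℝ :=
  sSup ((fun ζ => inner ℝ ζ x) '' A)

/-- The matrix `E[h(W, θ) h(W, θ)ᵀ]`, which is `Cov[h(W, θ)]` when `E[h(W, θ)] = 0`. -/
def covMatrix {m l r : ℕ} {Ω : Type*} [MeasurableSpace Ω] (μ : Measure Ω)
    (h : EuclideanSpace ℝ (Fin m) → EuclideanSpace ℝ (Fin l) → EuclideanSpace ℝ (Fin r))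
    (θ : EuclideanSpace ℝ (Fin l)) (W : Ω → EuclideanSpace ℝ (Fin m)) :
    Matrix (Fin r) (Fin r) ℝ :=
  Matrix.of fun i j => ∫ ω, h (W ω) θ i * h (W ω) θ j ∂μ

end RWP

end

/-! The proof squeezes the profile between a dual lower bound and a finite linear program. Let `A`
be the set of `ζ` for which `ζᵀh` is `1`-Lipschitz in `ℓ_q`, `S` its support function and `x` minus
the sample mean of `h`. Since `h` is `C¹` and `W` charges every nonempty open set, `A` is the dual
set (`dualSet_eq_lipSet`); nondegeneracy makes it compact. Lower bound
(`ofReal_inner_neg_mean_le_profile`): integrating `ζᵀ(h(U) - h(V)) ≤ ‖U - V‖_q` against any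
admissible coupling gives `R_n ≥ S(x)`. Upper bound (`ae_eventually_profile_le`): each `ζ` at
distance exactly `ε` from `A` is violated by a move, carrying the mass of a small ball to one point,
whose expected gain along `ζ` exceeds its expected cost. Finitely many moves handle this whole
shell, and by the law of large numbers they still do so for the empirical measure. The vectors `ζ`
that respect all moves form a convex set containing `0` and missing the shell, hence within `ε` of
`A`. Linear programming duality (`exists_nonneg_combination`) then combines the moves into a
transport that corrects the mean at cost at most `S(x) + ε‖x‖`. It uses a total fraction at most `1`
once `x` is small. Hence `R_n = S(x) + o(‖x‖)` almost surely. As `S` is even, continuous and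
positively homogeneous, the central limit theorem and Slutsky's theorem finish the proof. -/

open Topology

namespace RWP

/-! ### The `ℓ_q` norm and its duality -/

section Norm

variable {q p : ℝ≥0∞} {k : ℕ}

lemma lqNorm_nonneg [Fact (1 ≤ q)] (v : EuclideanSpace ℝ (Fin k)) : 0 ≤ lqNorm q v :=
  norm_nonneg _

lemma lqNorm_zero [Fact (1 ≤ q)] : lqNorm q (0 : EuclideanSpace ℝ (Fin k)) = 0 := by
  simp [lqNorm]

lemma lqNorm_add_le [Fact (1 ≤ q)] (v w : EuclideanSpace ℝ (Fin k)) :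
    lqNorm q (v + w) ≤ lqNorm q v + lqNorm q w := by
  simpa [lqNorm] using norm_add_le (WithLp.toLp q v.ofLp) (WithLp.toLp q w.ofLp)

lemma lqNorm_smul [Fact (1 ≤ q)] (a : ℝ) (v : EuclideanSpace ℝ (Fin k)) :
    lqNorm q (a • v) = |a| * lqNorm q v := by
  simpa [lqNorm] using norm_smul a (WithLp.toLp q v.ofLp)

lemma lqNorm_neg [Fact (1 ≤ q)] (v : EuclideanSpace ℝ (Fin k)) : lqNorm q (-v) = lqNorm q v := by
  simpa using lqNorm_smul (q := q) (-1) v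

lemma lqNorm_sub_comm [Fact (1 ≤ q)] (v w : EuclideanSpace ℝ (Fin k)) :
    lqNorm q (v - w) = lqNorm q (w - v) := by
  rw [← lqNorm_neg, neg_sub]

lemma lqNorm_pos [Fact (1 ≤ q)] {v : EuclideanSpace ℝ (Fin k)} (hv : v ≠ 0) : 0 < lqNorm q v := by
  refine norm_pos_iff.2 fun h0 => hv ?_
  ext i
  simpa using congrArg (fun z : PiLp q (fun _ : Fin k => ℝ) => z.ofLp i) h0

lemma continuous_lqNorm [Fact (1 ≤ q)] :
    Continuous (lqNorm q : EuclideanSpace ℝ (Fin k) → ℝ) := by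
  unfold lqNorm
  exact continuous_norm.comp ((PiLp.continuous_toLp q _).comp (PiLp.continuous_ofLp 2 _))

lemma inner_eq_sum (x y : EuclideanSpace ℝ (Fin k)) : inner ℝ x y = ∑ i, x i * y i := by
  simp [PiLp.inner_apply, mul_comm]

/-- Conjugate exponents are `(∞, 1)`, `(1, ∞)`, or conjugate real exponents. -/
lemma conjugate_cases (hpq : 1 / p + 1 / q = 1) :
    (p = ∞ ∧ q = 1) ∨ (p = 1 ∧ q = ∞) ∨ (p.toReal.HolderConjugate q.toReal) := by
  have hc : ENNReal.HolderConjugate p q := ⟨by simpa using hpq⟩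
  rcases eq_or_ne p 1 with rfl | hp1
  · refine Or.inr (Or.inl ⟨rfl, ?_⟩)
    have h2 : (1 : ℝ≥0∞) + 1 / q = 1 + 0 := by simpa using hpq
    have := (ENNReal.add_right_inj ENNReal.one_ne_top).1 h2
    simpa using this
  rcases eq_or_ne p ∞ with rfl | hpt
  · refine Or.inl ⟨rfl, ?_⟩
    simpa using hpq
  · refine Or.inr (Or.inr ?_)
    have : 1 ≤ p := hc.one_le
    have h1 : 1 < p := lt_of_le_of_ne this (Ne.symm hp1)
    exact ENNReal.HolderConjugate.toReal
      ((ENNReal.toReal_lt_toReal ENNReal.one_ne_top hpt).2 h1)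

lemma lqNorm_one (v : EuclideanSpace ℝ (Fin k)) : lqNorm 1 v = ∑ i, |v i| := by
  simp [lqNorm, PiLp.norm_eq_of_L1]

lemma abs_le_lqNorm_top (v : EuclideanSpace ℝ (Fin k)) (i : Fin k) : |v i| ≤ lqNorm ∞ v := by
  simpa [lqNorm] using PiLp.norm_apply_le (WithLp.toLp ∞ v.ofLp) i

lemma lqNorm_of_toReal_pos (hq : 0 < q.toReal) (v : EuclideanSpace ℝ (Fin k)) :
    lqNorm q v = (∑ i, |v i| ^ q.toReal) ^ (1 / q.toReal) := by
  simp [lqNorm, PiLp.norm_eq_sum hq]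

/-- Hölder's inequality for conjugate exponents in `[1, ∞]`. -/
lemma inner_le_lqNorm_mul_lqNorm (hpq : 1 / p + 1 / q = 1) (x y : EuclideanSpace ℝ (Fin k)) :
    inner ℝ x y ≤ lqNorm p x * lqNorm q y := by
  rw [inner_eq_sum]
  rcases conjugate_cases hpq with ⟨rfl, rfl⟩ | ⟨rfl, rfl⟩ | h
  · rw [lqNorm_one, Finset.mul_sum]
    refine Finset.sum_le_sum fun i _ => (le_abs_self _).trans ?_
    rw [abs_mul]
    exact mul_le_mul_of_nonneg_right (abs_le_lqNorm_top x i) (abs_nonneg _)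
  · rw [lqNorm_one, Finset.sum_mul]
    refine Finset.sum_le_sum fun i _ => (le_abs_self _).trans ?_
    rw [abs_mul]
    exact mul_le_mul_of_nonneg_left (abs_le_lqNorm_top y i) (abs_nonneg _)
  · rw [lqNorm_of_toReal_pos h.pos, lqNorm_of_toReal_pos h.symm.pos]
    exact Real.inner_le_Lp_mul_Lq _ _ _ h

lemma sign_mul_self' (a : ℝ) : a * SignType.sign a = |a| := by
  rw [mul_comm, sign_mul_self]

/-- The dual norm is attained. -/
lemma exists_inner_eq_lqNorm (hpq : 1 / p + 1 / q = 1) (x : EuclideanSpace ℝ (Fin k)) :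
    ∃ y : EuclideanSpace ℝ (Fin k), lqNorm q y ≤ 1 ∧ inner ℝ x y = lqNorm p x := by
  rcases conjugate_cases hpq with ⟨rfl, rfl⟩ | ⟨rfl, rfl⟩ | h
  -- Extremal vectors: a signed basis vector at a largest coordinate (absent when `k = 0`), the sign
  -- vector, and the Hölder maximizer for `|x|` with the signs of `x` restored.
  · rcases isEmpty_or_nonempty (Fin k) with hk | hk
    · refine ⟨0, by simp [lqNorm], ?_⟩
      rw [Subsingleton.elim x 0]
      simp [lqNorm]
    · obtain ⟨i, hi⟩ := exists_eq_ciSup_of_finite (f := fun i => |x i|)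
      refine ⟨EuclideanSpace.single i (SignType.sign (x i) : ℝ), ?_, ?_⟩
      · rw [lqNorm_one, Finset.sum_eq_single i]
        · rcases lt_trichotomy (x i) 0 with h | h | h <;> simp [h]
        · intro j _ hj
          simp [hj]
        · simp
      · rw [inner_eq_sum, Finset.sum_eq_single i]
        · simp only [PiLp.single_apply, if_true, sign_mul_self', hi]
          simp [lqNorm, PiLp.norm_eq_ciSup]
        · intro j _ hj
          simp [hj]
        · simp
  · refine ⟨WithLp.toLp 2 fun i => (SignType.sign (x i) : ℝ), ?_, ?_⟩
    · unfold lqNorm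
      rw [PiLp.norm_toLp, pi_norm_le_iff_of_nonneg zero_le_one]
      intro i
      rcases lt_trichotomy (x i) 0 with h | h | h <;> simp [h]
    · rw [inner_eq_sum, lqNorm_one]
      simp
  · obtain ⟨⟨g, hg, hfg⟩, -⟩ :=
      NNReal.isGreatest_Lp (Finset.univ : Finset (Fin k)) (fun i => Real.nnabs (x i)) h
    refine ⟨WithLp.toLp 2 fun i => (SignType.sign (x i) : ℝ) * g i, ?_, ?_⟩
    · rw [lqNorm_of_toReal_pos h.symm.pos]
      refine Real.rpow_le_one (Finset.sum_nonneg fun i _ => by positivity) ?_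
        (by have := h.symm.pos; positivity)
      have hg' : ∑ i, (g i : ℝ) ^ q.toReal ≤ 1 := by exact_mod_cast hg
      refine le_trans (Finset.sum_le_sum fun i _ => ?_) hg'
      refine Real.rpow_le_rpow (abs_nonneg _) ?_ h.symm.nonneg
      rw [abs_mul, NNReal.abs_eq]
      refine mul_le_of_le_one_left (g i).2 ?_
      rcases lt_trichotomy (x i) 0 with h | h | h <;> simp [h]
    · rw [inner_eq_sum, lqNorm_of_toReal_pos h.pos]
      have := congrArg (NNReal.toReal) hfg
      push_cast at this
      rw [← this]
      refine Finset.sum_congr rfl fun i _ => ?_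
      rw [← mul_assoc, sign_mul_self']

end Norm

end RWP

namespace RWP

/-! ### Lipschitz description, compactness and symmetry of the dual set -/

section DualSet

/-- The vectors `ζ` for which `ζᵀ g` is `1`-Lipschitz for the `ℓ_q` norm. -/
def lipSet (q : ℝ≥0∞) {m r : ℕ} (g : EuclideanSpace ℝ (Fin m) → EuclideanSpace ℝ (Fin r)) :
    Set (EuclideanSpace ℝ (Fin r)) :=
  {ζ | ∀ u w, inner ℝ ζ (g u - g w) ≤ lqNorm q (u - w)}

variable {m l r : ℕ} {p q : ℝ≥0∞}

lemma inner_rowDeriv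
    (h : EuclideanSpace ℝ (Fin m) → EuclideanSpace ℝ (Fin l) → EuclideanSpace ℝ (Fin r))
    (θ : EuclideanSpace ℝ (Fin l)) (ζ : EuclideanSpace ℝ (Fin r)) (w y : EuclideanSpace ℝ (Fin m)) :
    inner ℝ (rowDeriv h θ ζ w) y = inner ℝ ζ (fderiv ℝ (fun u => h u θ) w y) := by
  have hy : y = ∑ j, y j • EuclideanSpace.single j (1 : ℝ) := by
    ext i
    simp [Finset.sum_apply, Pi.single_apply]
  conv_rhs => rw [hy]
  rw [map_sum, inner_sum, inner_eq_sum]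
  refine Finset.sum_congr rfl fun j _ => ?_
  simp [rowDeriv, inner_smul_right, mul_comm]

lemma continuous_rowDeriv
    {h : EuclideanSpace ℝ (Fin m) → EuclideanSpace ℝ (Fin l) → EuclideanSpace ℝ (Fin r)}
    {θ : EuclideanSpace ℝ (Fin l)} (hdiff : ContDiff ℝ 1 (fun w => h w θ))
    (ζ : EuclideanSpace ℝ (Fin r)) : Continuous (rowDeriv h θ ζ) := by
  unfold rowDeriv
  refine (PiLp.continuous_toLp 2 _).comp (continuous_pi fun j => ?_)
  exact continuous_const.inner ((hdiff.continuous_fderiv one_ne_zero).clm_apply continuous_const)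

lemma hasDerivAt_inner_segment {g : EuclideanSpace ℝ (Fin m) → EuclideanSpace ℝ (Fin r)}
    (hg : Differentiable ℝ g) (ζ : EuclideanSpace ℝ (Fin r)) (w y : EuclideanSpace ℝ (Fin m))
    (t : ℝ) : HasDerivAt (fun t : ℝ => inner ℝ ζ (g (w + t • y)))
      (inner ℝ ζ (fderiv ℝ g (w + t • y) y)) t := by
  have h1 : HasDerivAt (fun t : ℝ => w + t • y) y t := by
    simpa using ((hasDerivAt_id t).smul_const y).const_add w
  have h2 := (hg (w + t • y)).hasFDerivAt.comp_hasDerivAt t h1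
  simpa using (hasDerivAt_const t ζ).inner ℝ h2

/-- `ζᵀ g` is `1`-Lipschitz if and only if its gradient has dual norm at most `1`. -/
lemma mem_lipSet_iff [Fact (1 ≤ q)] (hpq : 1 / p + 1 / q = 1)
    {h : EuclideanSpace ℝ (Fin m) → EuclideanSpace ℝ (Fin l) → EuclideanSpace ℝ (Fin r)}
    {θ : EuclideanSpace ℝ (Fin l)} (hdiff : ContDiff ℝ 1 (fun w => h w θ))
    (ζ : EuclideanSpace ℝ (Fin r)) :
    ζ ∈ lipSet q (fun w => h w θ) ↔ ∀ w, lqNorm p (rowDeriv h θ ζ w) ≤ 1 := by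
  have hd : Differentiable ℝ (fun w => h w θ) := hdiff.differentiable one_ne_zero
  constructor
  · intro hζ w
    -- The Lipschitz bound is tested along the direction extremal for the gradient; right difference
    -- quotients suffice.
    obtain ⟨y, hy, hxy⟩ := exists_inner_eq_lqNorm hpq (rowDeriv h θ ζ w)
    rw [← hxy, inner_rowDeriv]
    have h1 := hasDerivAt_inner_segment hd ζ w y 0
    rw [zero_smul, add_zero] at h1
    refine le_of_tendsto (hasDerivAt_iff_tendsto_slope_zero.1 h1 |>.mono_left
      (nhdsWithin_mono 0 (s := Set.Ioi (0 : ℝ)) fun t ht => ne_of_gt ht)) ?_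
    filter_upwards [self_mem_nhdsWithin] with t ht
    have ht : 0 < t := ht
    rw [smul_eq_mul, inv_mul_le_iff₀ ht, mul_one, zero_add, zero_smul, add_zero, ← inner_sub_right]
    refine (hζ _ _).trans ?_
    rw [add_sub_cancel_left, lqNorm_smul, abs_of_pos ht]
    exact mul_le_of_le_one_right ht.le hy
  · intro hζ u w
    -- Mean value theorem on the segment from `w` to `u`, then Hölder.
    obtain ⟨t, -, ht⟩ := exists_hasDerivAt_eq_slope
      (fun t : ℝ => inner ℝ ζ (h (w + t • (u - w)) θ)) _ one_pos
      (fun t _ => (hasDerivAt_inner_segment hd ζ w (u - w) t).continuousAt.continuousWithinAt)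
      (fun t _ => hasDerivAt_inner_segment hd ζ w (u - w) t)
    simp only [one_smul, add_sub_cancel, zero_smul, add_zero, sub_zero, div_one,
      ← inner_sub_right] at ht
    rw [← ht, ← inner_rowDeriv]
    refine (inner_le_lqNorm_mul_lqNorm hpq _ _).trans ?_
    exact mul_le_of_le_one_left (lqNorm_nonneg _) (hζ _)

variable {Ω : Type*} [MeasurableSpace Ω] {μ : Measure Ω} {W : Ω → EuclideanSpace ℝ (Fin m)}

/-- Lebesgue measure is absolutely continuous with respect to the law of `W`. This upgrades almost
sure conditions on continuous functions to conditions at every point. -/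
lemma isOpenPosMeasure_map_of_pdf_pos [HasPDF W μ volume]
    (hpos : ∀ᵐ w ∂(volume : Measure (EuclideanSpace ℝ (Fin m))), 0 < pdf W μ volume w) :
    (μ.map W).IsOpenPosMeasure := by
  have hac : (volume : Measure (EuclideanSpace ℝ (Fin m))) ≪ μ.map W := by
    rw [map_eq_withDensity_pdf W μ volume]
    exact withDensity_absolutelyContinuous' (measurable_pdf W μ volume).aemeasurable
      (hpos.mono fun w hw => hw.ne')
  exact hac.isOpenPosMeasure

lemma dualSet_eq_lipSet [Fact (1 ≤ p)] [Fact (1 ≤ q)] (hpq : 1 / p + 1 / q = 1)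
    {h : EuclideanSpace ℝ (Fin m) → EuclideanSpace ℝ (Fin l) → EuclideanSpace ℝ (Fin r)}
    {θ : EuclideanSpace ℝ (Fin l)} (hdiff : ContDiff ℝ 1 (fun w => h w θ))
    (hW : AEMeasurable W μ) [(μ.map W).IsOpenPosMeasure] :
    dualSet μ p h θ W = lipSet q (fun w => h w θ) := by
  ext ζ
  rw [mem_lipSet_iff hpq hdiff]
  have hopen : IsOpen {w | 1 < lqNorm p (rowDeriv h θ ζ w)} :=
    isOpen_lt continuous_const (continuous_lqNorm.comp (continuous_rowDeriv hdiff ζ))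
  have : μ {ω | 1 < lqNorm p (rowDeriv h θ ζ (W ω))} =
      μ.map W {w | 1 < lqNorm p (rowDeriv h θ ζ w)} :=
    (Measure.map_apply_of_aemeasurable hW hopen.measurableSet).symm
  change μ {ω | 1 < lqNorm p (rowDeriv h θ ζ (W ω))} = 0 ↔ _
  rw [this, hopen.measure_eq_zero_iff (μ.map W), Set.eq_empty_iff_forall_notMem]
  simp

variable {g : EuclideanSpace ℝ (Fin m) → EuclideanSpace ℝ (Fin r)}

lemma zero_mem_lipSet [Fact (1 ≤ q)] : (0 : EuclideanSpace ℝ (Fin r)) ∈ lipSet q g := by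
  intro u w
  simpa using lqNorm_nonneg _

lemma neg_mem_lipSet [Fact (1 ≤ q)] {ζ : EuclideanSpace ℝ (Fin r)} (hζ : ζ ∈ lipSet q g) :
    -ζ ∈ lipSet q g := by
  intro u w
  rw [inner_neg_left, ← inner_neg_right, neg_sub, lqNorm_sub_comm]
  exact hζ w u

lemma isClosed_lipSet : IsClosed (lipSet q g) := by
  simp only [lipSet, Set.ofPred_forall]
  exact isClosed_iInter fun u => isClosed_iInter fun w =>
    isClosed_le (by fun_prop) continuous_const

/-- If no nonzero `ζᵀ g` is constant, then only boundedly many `ζᵀ g` are `1`-Lipschitz. -/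
lemma isCompact_lipSet [Fact (1 ≤ q)]
    (hg : ∀ ζ : EuclideanSpace ℝ (Fin r), ζ ≠ 0 → ∃ u w, 0 < inner ℝ ζ (g u - g w)) :
    IsCompact (lipSet q g) := by
  have key : ∃ R : ℝ, ∀ ζ ∈ Metric.sphere (0 : EuclideanSpace ℝ (Fin r)) 1, ∀ t : ℝ, 0 ≤ t →
      t • ζ ∈ lipSet q g → t ≤ R := by
    refine (isCompact_sphere (0 : EuclideanSpace ℝ (Fin r)) 1).induction_on
      (p := fun s => ∃ R : ℝ, ∀ ζ ∈ s, ∀ t : ℝ, 0 ≤ t → t • ζ ∈ lipSet q g → t ≤ R)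
      ⟨0, by simp⟩ ?_ ?_ ?_
    · rintro s t hst ⟨R, hR⟩
      exact ⟨R, fun ζ hζ => hR ζ (hst hζ)⟩
    · rintro s t ⟨R, hR⟩ ⟨R', hR'⟩
      refine ⟨max R R', ?_⟩
      rintro ζ (hζ | hζ) a ha hmem
      · exact (hR ζ hζ a ha hmem).trans (le_max_left _ _)
      · exact (hR' ζ hζ a ha hmem).trans (le_max_right _ _)
    · intro ζ hζ
      have hζ0 : ζ ≠ 0 := by
        rintro rfl
        simp at hζ
      obtain ⟨u, w, huw⟩ := hg ζ hζ0
      -- Halving leaves room for a neighbourhood of `ζ` on which the same pair `(u, w)` forces `t *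
      -- δ ≤ ‖u - w‖_q`.
      set δ := inner ℝ ζ (g u - g w) / 2 with hδ
      have hδ0 : 0 < δ := by positivity
      refine ⟨{z | δ < inner ℝ z (g u - g w)}, mem_nhdsWithin_of_mem_nhds
        ((isOpen_lt continuous_const (by fun_prop)).mem_nhds ?_), lqNorm q (u - w) / δ, ?_⟩
      · change δ < _
        linarith
      · intro z hz t ht hmem
        have h1 := hmem u w
        rw [inner_smul_left] at h1
        rw [le_div_iff₀ hδ0]
        exact (mul_le_mul_of_nonneg_left (le_of_lt hz) ht).trans h1
  obtain ⟨R, hR⟩ := key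
  refine Metric.isCompact_of_isClosed_isBounded isClosed_lipSet
    ((Metric.isBounded_closedBall (x := (0 : EuclideanSpace ℝ (Fin r))) (r := max R 0)).subset ?_)
  intro ζ hζ
  rw [mem_closedBall_zero_iff]
  rcases eq_or_ne ζ 0 with rfl | h0
  · simp
  · refine le_max_of_le_left (hR (‖ζ‖⁻¹ • ζ) ?_ ‖ζ‖ (norm_nonneg _) ?_)
    · simp [norm_smul, h0]
    · rwa [smul_smul, mul_inv_cancel₀ (norm_ne_zero_iff.2 h0), one_smul]

/-! ### Support functions of compact sets -/

section SupLinear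

variable {A : Set (EuclideanSpace ℝ (Fin r))}

lemma isGreatest_supLinear (hA : IsCompact A) (hne : A.Nonempty) (x : EuclideanSpace ℝ (Fin r)) :
    IsGreatest ((fun ζ => inner ℝ ζ x) '' A) (supLinear A x) :=
  (hA.image (by fun_prop)).isGreatest_sSup (hne.image _)

lemma inner_le_supLinear (hA : IsCompact A) {ζ : EuclideanSpace ℝ (Fin r)} (hζ : ζ ∈ A)
    (x : EuclideanSpace ℝ (Fin r)) : inner ℝ ζ x ≤ supLinear A x :=
  (isGreatest_supLinear hA ⟨ζ, hζ⟩ x).2 ⟨ζ, hζ, rfl⟩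

lemma continuous_supLinear (hA : IsCompact A) : Continuous (supLinear A) := by
  unfold supLinear
  refine hA.continuous_sSup (f := fun x ζ => inner ℝ ζ x) ?_
  exact continuous_snd.inner continuous_fst

lemma supLinear_smul_of_nonneg {c : ℝ} (hc : 0 ≤ c) (hA : IsCompact A) (hne : A.Nonempty)
    (x : EuclideanSpace ℝ (Fin r)) : supLinear A (c • x) = c * supLinear A x := by
  refine (isGreatest_supLinear hA hne (c • x)).unique ⟨?_, ?_⟩
  · obtain ⟨ζ, hζ, h⟩ := (isGreatest_supLinear hA hne x).1
    refine ⟨ζ, hζ, ?_⟩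
    simp only [← h, inner_smul_right]
  · rintro _ ⟨ζ, hζ, rfl⟩
    simp only [inner_smul_right]
    exact mul_le_mul_of_nonneg_left (inner_le_supLinear hA hζ x) hc

lemma supLinear_neg (hA : IsCompact A) (hne : A.Nonempty) (hneg : ∀ ζ ∈ A, -ζ ∈ A)
    (x : EuclideanSpace ℝ (Fin r)) : supLinear A (-x) = supLinear A x := by
  refine (isGreatest_supLinear hA hne (-x)).unique ⟨?_, ?_⟩
  · obtain ⟨ζ, hζ, h⟩ := (isGreatest_supLinear hA hne x).1
    refine ⟨-ζ, hneg ζ hζ, ?_⟩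
    simp [← h]
  · rintro _ ⟨ζ, hζ, rfl⟩
    simpa using inner_le_supLinear hA (hneg ζ hζ) x

end SupLinear

end DualSet

end RWP

namespace RWP

/-! ### Transport cost, and elementary bounds on the profile -/

section Transport

variable {m l r : ℕ} {q : ℝ≥0∞}
  {c : EuclideanSpace ℝ (Fin m) → EuclideanSpace ℝ (Fin m) → ℝ≥0∞}

lemma cost_one (u w : EuclideanSpace ℝ (Fin m)) :
    cost q 1 u w = ENNReal.ofReal (lqNorm q (u - w)) := by
  simp [cost]

lemma cost_one_triangle [Fact (1 ≤ q)] (u v w : EuclideanSpace ℝ (Fin m)) :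
    cost q 1 u w ≤ cost q 1 u v + cost q 1 v w := by
  simp only [cost_one]
  rw [← ENNReal.ofReal_add (lqNorm_nonneg _) (lqNorm_nonneg _)]
  refine ENNReal.ofReal_le_ofReal ?_
  simpa using lqNorm_add_le (q := q) (u - v) (v - w)

lemma measurable_cost_one [Fact (1 ≤ q)] : Measurable
    fun z : EuclideanSpace ℝ (Fin m) × EuclideanSpace ℝ (Fin m) => cost q 1 z.1 z.2 := by
  simp only [cost_one]
  exact (continuous_lqNorm.comp (by fun_prop)).measurable.ennreal_ofReal

/-- Used in gluing: the kernel sees only the middle variable, so forgetting the first one recovers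
the second coupling. -/
lemma map_compProd_comap {α β γ : Type*} [MeasurableSpace α] [MeasurableSpace β]
    [MeasurableSpace γ] (μ : Measure α) [SFinite μ] (κ : Kernel β γ) [IsSFiniteKernel κ]
    {f : α → β} (hf : Measurable f) :
    (μ ⊗ₘ κ.comap f hf).map (Prod.map f id) = μ.map f ⊗ₘ κ := by
  ext s hs
  rw [Measure.map_apply (by fun_prop) hs, Measure.compProd_apply (by measurability),
    Measure.compProd_apply hs, lintegral_map (Kernel.measurable_kernel_prodMk_left hs) hf]
  rfl

/-- Gluing two couplings gives the triangle inequality for the transport cost. -/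
lemma transportCost_triangle (hc : Measurable fun z : _ × _ => c z.1 z.2)
    (htri : ∀ u v w, c u w ≤ c u v + c v w) (P Q R : Measure (EuclideanSpace ℝ (Fin m))) :
    transportCost c P R ≤ transportCost c P Q + transportCost c Q R := by
  conv_rhs => simp only [transportCost]
  simp only [ENNReal.iInf_add]
  refine le_iInf₂ fun π₁ ⟨h₁, h₁P, h₁Q⟩ => ?_
  simp only [ENNReal.add_iInf]
  refine le_iInf₂ fun π₂ ⟨h₂, h₂Q, h₂R⟩ => ?_
  -- Law of a triple: the first two entries follow `π₁`, and the third is drawn from `π₂`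
  -- conditionally on the second.
  set γ := π₁ ⊗ₘ (π₂.condKernel.comap Prod.snd measurable_snd) with hγ
  have hγfst : γ.map Prod.fst = π₁ := Measure.fst_compProd _ _
  have hγsnd : γ.map (fun z => (z.1.2, z.2)) = π₂ := by
    change γ.map (Prod.map Prod.snd id) = π₂
    rw [hγ, map_compProd_comap _ _ measurable_snd, h₁Q, ← h₂Q]
    exact π₂.disintegrate π₂.condKernel
  refine iInf₂_le_of_le (γ.map fun z => (z.1.1, z.2)) ⟨?_, ?_, ?_⟩ ?_
  · exact Measure.isProbabilityMeasure_map (by fun_prop)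
  · rw [Measure.map_map (by fun_prop) (by fun_prop), ← h₁P, ← hγfst,
      Measure.map_map (by fun_prop) (by fun_prop)]
    rfl
  · rw [Measure.map_map (by fun_prop) (by fun_prop), ← h₂R, ← hγsnd,
      Measure.map_map (by fun_prop) (by fun_prop)]
    rfl
  · rw [lintegral_map hc (by fun_prop)]
    conv_rhs => rw [← hγfst, ← hγsnd]
    have hm : Measurable fun z : (EuclideanSpace ℝ (Fin m) × EuclideanSpace ℝ (Fin m)) ×
        EuclideanSpace ℝ (Fin m) => c z.1.1 z.1.2 := hc.comp measurable_fst
    rw [lintegral_map hc (by fun_prop), lintegral_map hc (by fun_prop),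
      ← lintegral_add_left hm]
    exact lintegral_mono fun z => htri _ _ _

lemma transportCost_sum_smul_dirac_le {ι : Type*} (s : Finset ι) (a : ι → ℝ≥0∞)
    (ha : ∑ k ∈ s, a k = 1) (u x : ι → EuclideanSpace ℝ (Fin m)) :
    transportCost c (∑ k ∈ s, a k • Measure.dirac (u k)) (∑ k ∈ s, a k • Measure.dirac (x k)) ≤
      ∑ k ∈ s, a k * c (u k) (x k) := by
  refine iInf₂_le_of_le (∑ k ∈ s, a k • Measure.dirac (u k, x k)) ⟨⟨?_⟩, ?_, ?_⟩ ?_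
  · simpa using ha
  · rw [Measure.map_finset_sum (by fun_prop)]
    simp [Measure.map_smul]
  · rw [Measure.map_finset_sum (by fun_prop)]
    simp [Measure.map_smul]
  · simp [lintegral_finsetSum_measure, lintegral_smul_measure]

lemma empiricalMeasure_eq_sum (n : ℕ) (w : ℕ → EuclideanSpace ℝ (Fin m)) :
    empiricalMeasure n w = ∑ i ∈ Finset.range n, (n : ℝ≥0∞)⁻¹ • Measure.dirac (w i) := by
  rw [empiricalMeasure, Finset.smul_sum]

lemma sum_range_inv_natCast {n : ℕ} (hn : 1 ≤ n) :
    ∑ _i ∈ Finset.range n, (n : ℝ≥0∞)⁻¹ = 1 := by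
  have : (n : ℝ≥0∞) ≠ 0 := by
    exact_mod_cast (by omega : n ≠ 0)
  simp [ENNReal.mul_inv_cancel this]

lemma transportCost_empiricalMeasure_le {n : ℕ} (hn : 1 ≤ n)
    (w w' : ℕ → EuclideanSpace ℝ (Fin m)) :
    transportCost c (empiricalMeasure n w) (empiricalMeasure n w') ≤
      ∑ i ∈ Finset.range n, (n : ℝ≥0∞)⁻¹ * c (w i) (w' i) := by
  rw [empiricalMeasure_eq_sum, empiricalMeasure_eq_sum]
  exact transportCost_sum_smul_dirac_le _ _ (sum_range_inv_natCast hn) _ _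

variable {h : EuclideanSpace ℝ (Fin m) → EuclideanSpace ℝ (Fin l) → EuclideanSpace ℝ (Fin r)}
  {θ : EuclideanSpace ℝ (Fin l)} {n : ℕ} {w w' : ℕ → EuclideanSpace ℝ (Fin m)}

/-- The constraint on `P` does not involve the sample, so the same `P` serves both samples. The
resulting continuity in the sample makes the profile measurable, which is not evident from an
infimum over measures. -/
lemma profile_le_profile_add [Fact (1 ≤ q)] (hn : 1 ≤ n) :
    profile q 1 h n w θ ≤
      profile q 1 h n w' θ + ∑ i ∈ Finset.range n, (n : ℝ≥0∞)⁻¹ * cost q 1 (w' i) (w i) := by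
  conv_rhs => simp only [profile]
  simp only [ENNReal.iInf_add]
  refine le_iInf₂ fun P hP => ?_
  refine iInf₂_le_of_le P hP ?_
  refine (transportCost_triangle measurable_cost_one cost_one_triangle _
    (empiricalMeasure n w') _).trans ?_
  gcongr
  exact transportCost_empiricalMeasure_le hn w' w

/-- Splitting the mass at each sample point gives a feasible measure and bounds the profile. -/
lemma profile_le_of_splitting [Fact (1 ≤ q)] {κ : Type*} [Fintype κ] (hn : 1 ≤ n) (b : ℕ → κ → ℝ)
    (hb0 : ∀ i k, 0 ≤ b i k) (hb1 : ∀ i, ∑ k, b i k = 1)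
    (u : ℕ → κ → EuclideanSpace ℝ (Fin m))
    (hmean : ∑ i ∈ Finset.range n, ∑ k, b i k • h (u i k) θ = 0) :
    profile q 1 h n w θ ≤ ENNReal.ofReal
      ((n : ℝ)⁻¹ * ∑ i ∈ Finset.range n, ∑ k, b i k * lqNorm q (u i k - w i)) := by
  have hn0 : 0 < (n : ℝ) := by exact_mod_cast hn
  set s : Finset (ℕ × κ) := Finset.range n ×ˢ Finset.univ with hs
  set a : ℕ × κ → ℝ≥0∞ := fun z => ENNReal.ofReal ((n : ℝ)⁻¹ * b z.1 z.2) with ha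
  have hnn : ENNReal.ofReal ((n : ℝ)⁻¹) = (n : ℝ≥0∞)⁻¹ := by
    rw [ENNReal.ofReal_inv_of_pos hn0, ENNReal.ofReal_natCast]
  have hrow : ∀ i, ∑ k, a (i, k) = (n : ℝ≥0∞)⁻¹ := by
    intro i
    rw [← ENNReal.ofReal_sum_of_nonneg fun k _ => mul_nonneg (by positivity) (hb0 i k),
      ← Finset.mul_sum, hb1, mul_one, hnn]
  have ha1 : ∑ z ∈ s, a z = 1 := by
    rw [hs, Finset.sum_product]
    simp only [hrow, sum_range_inv_natCast hn]
  -- Each atom of the empirical measure is cut into its pieces, so that source and target are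
  -- indexed by the same set.
  have hemp : empiricalMeasure n w = ∑ z ∈ s, a z • Measure.dirac (w z.1) := by
    rw [hs, Finset.sum_product, empiricalMeasure_eq_sum]
    simp only [← Finset.sum_smul, hrow]
  have hfin : ∀ z ∈ s, Integrable (fun v => h v θ) (a z • Measure.dirac (u z.1 z.2)) :=
    fun z _ => (integrable_dirac (by simp)).smul_measure ENNReal.ofReal_ne_top
  refine iInf₂_le_of_le (∑ z ∈ s, a z • Measure.dirac (u z.1 z.2)) ⟨⟨?_⟩, ?_, ?_⟩ ?_
  · simpa using ha1
  · exact integrable_finsetSum_measure.2 hfin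
  · rw [integral_finsetSum_measure hfin]
    have : ∀ z ∈ s, ∫ v, h v θ ∂(a z • Measure.dirac (u z.1 z.2)) =
        (n : ℝ)⁻¹ • (b z.1 z.2 • h (u z.1 z.2) θ) := by
      intro z _
      rw [integral_smul_measure, integral_dirac, ha,
        ENNReal.toReal_ofReal (mul_nonneg (by positivity) (hb0 _ _)), smul_smul]
    rw [Finset.sum_congr rfl this, ← Finset.smul_sum, hs, Finset.sum_product, hmean, smul_zero]
  · rw [hemp]
    refine (transportCost_sum_smul_dirac_le s a ha1 _ _).trans (le_of_eq ?_)
    rw [Finset.mul_sum]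
    simp only [Finset.mul_sum]
    rw [← Finset.sum_product' (Finset.range n) Finset.univ
        (fun i k => (n : ℝ)⁻¹ * (b i k * lqNorm q (u i k - w i))), ENNReal.ofReal_sum_of_nonneg]
    · refine Finset.sum_congr rfl fun z _ => ?_
      rw [ha, cost_one, ← ENNReal.ofReal_mul (mul_nonneg (by positivity) (hb0 _ _)), mul_assoc]
    · exact fun z _ => mul_nonneg (by positivity) (mul_nonneg (hb0 _ _) (lqNorm_nonneg _))

lemma ofReal_integral_le_lintegral_ofReal {α : Type*} [MeasurableSpace α] {μ : Measure α}
    {f : α → ℝ} (hf : Integrable f μ) :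
    ENNReal.ofReal (∫ x, f x ∂μ) ≤ ∫⁻ x, ENNReal.ofReal (f x) ∂μ := by
  rw [integral_eq_lintegral_pos_part_sub_lintegral_neg_part hf]
  refine (ENNReal.ofReal_le_ofReal (sub_le_self _ ENNReal.toReal_nonneg)).trans ?_
  exact ENNReal.ofReal_toReal_le

/-- Weak duality: `-ζᵀ E_n[h]` bounds the profile from below if `ζᵀ h` is `1`-Lipschitz. -/
lemma ofReal_inner_neg_mean_le_profile (hn : 1 ≤ n) (hcont : Continuous fun v => h v θ)
    {ζ : EuclideanSpace ℝ (Fin r)} (hζ : ζ ∈ lipSet q fun v => h v θ) :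
    ENNReal.ofReal (inner ℝ ζ (-((n : ℝ)⁻¹ • ∑ i ∈ Finset.range n, h (w i) θ))) ≤
      profile q 1 h n w θ := by
  refine le_iInf₂ fun P ⟨hP, hPi, hP0⟩ => le_iInf₂ fun π ⟨hπ, hπ1, hπ2⟩ => ?_
  have hn0 : (n : ℝ≥0∞)⁻¹ ≠ ∞ := by
    simp only [ne_eq, ENNReal.inv_eq_top, Nat.cast_eq_zero]
    omega
  have hdi : ∀ i ∈ Finset.range n, Integrable (fun v => h v θ)
      ((n : ℝ≥0∞)⁻¹ • Measure.dirac (w i)) :=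
    fun i _ => (integrable_dirac (by simp)).smul_measure hn0
  have hei : Integrable (fun v => h v θ) (empiricalMeasure n w) := by
    rw [empiricalMeasure_eq_sum]
    exact integrable_finsetSum_measure.2 hdi
  have he : ∫ v, h v θ ∂(empiricalMeasure n w) = (n : ℝ)⁻¹ • ∑ i ∈ Finset.range n, h (w i) θ := by
    rw [empiricalMeasure_eq_sum, integral_finsetSum_measure hdi, Finset.smul_sum]
    simp [integral_smul_measure]
  rw [← hπ1] at hPi hP0
  rw [← hπ2] at hei he
  rw [integral_map (by fun_prop) hcont.aestronglyMeasurable] at he hP0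
  have h1 : Integrable (fun z => h z.1 θ) π := hPi.comp_measurable measurable_fst
  have h2 : Integrable (fun z => h z.2 θ) π := hei.comp_measurable measurable_snd
  have h12 : Integrable (fun z => h z.1 θ - h z.2 θ) π := h1.sub h2
  have hint : ∫ z, inner ℝ ζ (h z.1 θ - h z.2 θ) ∂π =
      inner ℝ ζ (-((n : ℝ)⁻¹ • ∑ i ∈ Finset.range n, h (w i) θ)) := by
    rw [integral_inner h12, integral_sub h1 h2, hP0, he, zero_sub]
  rw [← hint]
  refine (ofReal_integral_le_lintegral_ofReal (h12.const_inner ζ)).trans ?_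
  refine lintegral_mono fun z => ?_
  rw [cost_one]
  exact ENNReal.ofReal_le_ofReal (hζ _ _)

/-- The profile is a continuous function of the sample points. -/
lemma continuous_profile_toReal [Fact (1 ≤ q)] (hn : 1 ≤ n)
    (hfin : ∀ w : ℕ → EuclideanSpace ℝ (Fin m), profile q 1 h n w θ ≠ ∞) :
    Continuous fun w : ℕ → EuclideanSpace ℝ (Fin m) => (profile q 1 h n w θ).toReal := by
  set d : (ℕ → EuclideanSpace ℝ (Fin m)) → (ℕ → EuclideanSpace ℝ (Fin m)) → ℝ :=
    fun w w' => ∑ i ∈ Finset.range n, (n : ℝ)⁻¹ * lqNorm q (w' i - w i) with hd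
  have hle : ∀ w w' : ℕ → EuclideanSpace ℝ (Fin m),
      (profile q 1 h n w θ).toReal ≤ (profile q 1 h n w' θ).toReal + d w w' := by
    intro w w'
    have hn0 : 0 < (n : ℝ) := by exact_mod_cast hn
    have hd0 : ∀ i ∈ Finset.range n, 0 ≤ (n : ℝ)⁻¹ * lqNorm q (w' i - w i) :=
      fun i _ => mul_nonneg (by positivity) (lqNorm_nonneg _)
    have hsum : ∑ i ∈ Finset.range n, (n : ℝ≥0∞)⁻¹ * cost q 1 (w' i) (w i) =
        ENNReal.ofReal (d w w') := by
      rw [hd, ENNReal.ofReal_sum_of_nonneg hd0]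
      refine Finset.sum_congr rfl fun i _ => ?_
      rw [cost_one, ENNReal.ofReal_mul (by positivity), ENNReal.ofReal_inv_of_pos hn0,
        ENNReal.ofReal_natCast]
    have h1 := profile_le_profile_add (q := q) (h := h) (θ := θ) (w := w) (w' := w') hn
    rw [hsum] at h1
    have h2 := ENNReal.toReal_mono (by simp [hfin]) h1
    rwa [ENNReal.toReal_add (hfin _) (by simp), ENNReal.toReal_ofReal (Finset.sum_nonneg hd0)] at h2
  have hsymm : ∀ w w', d w w' = d w' w := fun w w' =>
    Finset.sum_congr rfl fun i _ => by rw [lqNorm_sub_comm]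
  rw [continuous_iff_continuousAt]
  intro w
  rw [ContinuousAt, tendsto_iff_dist_tendsto_zero]
  have hdc : Tendsto (fun w' => d w w') (𝓝 w) (𝓝 0) := by
    have hc : Continuous fun w' => d w w' := by
      refine continuous_finsetSum _ fun i _ => continuous_const.mul ?_
      exact continuous_lqNorm.comp (by fun_prop)
    have := hc.tendsto w
    simpa [hd, lqNorm_zero] using this
  refine squeeze_zero (fun _ => dist_nonneg) (fun w' => ?_) hdc
  rw [Real.dist_eq, abs_le]
  constructor
  · linarith [hle w w']
  · linarith [hle w' w, hsymm w w']

end Transport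

end RWP

namespace RWP

/-! ### Finite-dimensional convex duality -/

section Duality

variable {F : Type*} [NormedAddCommGroup F] [InnerProductSpace ℝ F]

/-- A convex set containing `0 ∈ A` that avoids the shell at distance `ε` stays `ε`-close to `A`. -/
lemma infDist_lt_of_disjoint_shell {A C : Set F} (hA : (0 : F) ∈ A) (hC : Convex ℝ C)
    (h0 : (0 : F) ∈ C) {ε : ℝ} (hε : 0 < ε) (hdisj : ∀ ζ ∈ C, Metric.infDist ζ A ≠ ε) {ζ : F}
    (hζ : ζ ∈ C) : Metric.infDist ζ A < ε := by
  by_contra! hle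
  -- Along the segment from `0` to `ζ`, which lies in `C`, the distance to `A` rises continuously
  -- from `0` and would have to take the value `ε`.
  have hcont : Continuous fun s : ℝ => Metric.infDist (s • ζ) A :=
    (Metric.continuous_infDist_pt A).comp (by fun_prop)
  have h := intermediate_value_Icc (zero_le_one (α := ℝ)) hcont.continuousOn
  obtain ⟨s, hs, hsε⟩ := h (show ε ∈ _ by
    simp only [zero_smul, one_smul, Metric.infDist_zero_of_mem hA]
    exact ⟨hε.le, hle⟩)
  refine hdisj (s • ζ) ?_ hsε
  exact hC.smul_mem_of_zero_mem h0 hζ hs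

/-- Finitely many strict half-space conditions covering a compact set are stable. -/
lemma eventually_forall_exists_lt_inner {J : Type*} [Fintype J] {K : Set F} (hK : IsCompact K)
    {a : J → F} {c : J → ℝ} (h : ∀ ζ ∈ K, ∃ j, c j < inner ℝ ζ (a j)) :
    ∀ᶠ z : (J → F) × (J → ℝ) in 𝓝 (a, c), ∀ ζ ∈ K, ∃ j, z.2 j < inner ℝ ζ (z.1 j) := by
  refine hK.eventually_forall_of_forall_eventually fun ζ hζ => ?_
  obtain ⟨j, hj⟩ := h ζ hζ
  have hopen : IsOpen {y : ((J → F) × (J → ℝ)) × F | y.1.2 j < inner ℝ y.2 (y.1.1 j)} :=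
    isOpen_lt (by fun_prop) (by fun_prop)
  filter_upwards [hopen.mem_nhds hj] with y hy
  exact ⟨j, hy⟩

variable [FiniteDimensional ℝ F]

lemma exists_inner_lt_of_notMem {K : Set F} (hconv : Convex ℝ K) (hcl : IsClosed K) {x : F}
    (hx : x ∉ K) : ∃ (ζ : F) (u : ℝ), inner ℝ ζ x < u ∧ ∀ y ∈ K, u < inner ℝ ζ y := by
  obtain ⟨f, u, h1, h2⟩ := geometric_hahn_banach_point_closed hconv hcl hx
  refine ⟨(InnerProductSpace.toDual ℝ F).symm f, u, ?_, fun y hy => ?_⟩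
  · simpa using h1
  · simpa using h2 y hy

/-- Finite linear programming duality. -/
lemma exists_nonneg_combination {J : Type*} [Fintype J] {a : J → F} {c : J → ℝ} (hc : ∀ j, 0 < c j)
    {x : F} {t : ℝ} (ht : 0 < t) (hx : ∀ ζ : F, (∀ j, inner ℝ ζ (a j) ≤ c j) → inner ℝ ζ x ≤ t) :
    ∃ b : J → ℝ, (∀ j, 0 ≤ b j) ∧ ∑ j, b j • a j = x ∧ ∑ j, b j * c j ≤ t := by
  -- Each `a j` is rescaled to cost exactly `t`; the vertex `0` absorbs unspent budget. The claim
  -- becomes that `x` lies in the convex hull of these vertices.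
  set y : Option J → F := fun k => k.elim 0 fun j => (t / c j) • a j with hy
  set L := Fintype.linearCombination ℝ y with hL
  have hK : IsCompact (L '' stdSimplex ℝ (Option J)) :=
    (isCompact_stdSimplex (𝕜 := ℝ) (Option J)).image L.continuous_of_finiteDimensional
  have hmem : ∀ k, y k ∈ L '' stdSimplex ℝ (Option J) := by
    classical
    intro k
    exact ⟨Pi.single k 1, single_mem_stdSimplex ℝ k, by simp [hL]⟩
  have hxK : x ∈ L '' stdSimplex ℝ (Option J) := by
    by_contra hxK
    obtain ⟨ζ, u, h1, h2⟩ :=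
      exists_inner_lt_of_notMem ((convex_stdSimplex ℝ _).linear_image L) hK.isClosed hxK
    have hu : u < 0 := by simpa [hy] using h2 _ (hmem none)
    -- Since `u < 0`, the multiple `(t / u) • ζ` of the separating vector satisfies every
    -- constraint, yet its product with `x` exceeds `t`.
    have h3 := hx ((t / u) • ζ) fun j => by
      have h4 := h2 _ (hmem (some j))
      simp only [hy, Option.elim_some, inner_smul_right] at h4
      rw [real_inner_smul_left, div_mul_eq_mul_div, div_le_iff_of_neg hu]
      rw [div_mul_eq_mul_div, lt_div_iff₀ (hc j)] at h4
      linarith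
    rw [real_inner_smul_left, div_mul_eq_mul_div, div_le_iff_of_neg hu] at h3
    linarith [le_of_mul_le_mul_left h3 ht]
  obtain ⟨b, ⟨hb0, hb1⟩, hbx⟩ := hxK
  refine ⟨fun j => b (some j) * (t / c j), fun j => mul_nonneg (hb0 _) (div_pos ht (hc j)).le,
    ?_, ?_⟩
  · rw [← hbx, hL, Fintype.linearCombination_apply, Fintype.sum_option]
    simp [hy, smul_smul]
  · rw [Fintype.sum_option] at hb1
    have : ∀ j, b (some j) * (t / c j) * c j = b (some j) * t := fun j => by
      rw [mul_assoc, div_mul_cancel₀ _ (hc j).ne']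
    simp only [this, ← Finset.sum_mul]
    exact mul_le_of_le_one_left ht.le (by linarith [hb0 none])

/-- If no half-space contains the range of `g`, then `0` is a convex combination of values. -/
lemma zero_mem_convexHull_range {E : Type*} [Nonempty E] {g : E → F}
    (hg : ∀ ζ : F, ζ ≠ 0 → ∃ v, 0 < inner ℝ ζ (g v)) : (0 : F) ∈ convexHull ℝ (Set.range g) := by
  classical
  have key : ∃ T : Finset E, ∀ ζ ∈ Metric.sphere (0 : F) 1, ∃ v ∈ T, 0 < inner ℝ ζ (g v) := by
    refine (isCompact_sphere (0 : F) 1).induction_on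
      (p := fun s => ∃ T : Finset E, ∀ ζ ∈ s, ∃ v ∈ T, 0 < inner ℝ ζ (g v)) ⟨∅, by simp⟩ ?_ ?_ ?_
    · rintro s t hst ⟨T, hT⟩
      exact ⟨T, fun ζ hζ => hT ζ (hst hζ)⟩
    · rintro s t ⟨T, hT⟩ ⟨T', hT'⟩
      refine ⟨T ∪ T', ?_⟩
      rintro ζ (hζ | hζ)
      · obtain ⟨v, hv, h⟩ := hT ζ hζ
        exact ⟨v, Finset.mem_union_left _ hv, h⟩
      · obtain ⟨v, hv, h⟩ := hT' ζ hζ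
        exact ⟨v, Finset.mem_union_right _ hv, h⟩
    · intro ζ hζ
      obtain ⟨v, hv⟩ := hg ζ (by rintro rfl; simp at hζ)
      exact ⟨{z | 0 < inner ℝ z (g v)}, mem_nhdsWithin_of_mem_nhds
        ((isOpen_lt continuous_const (by fun_prop)).mem_nhds hv), {v}, by simp⟩
  obtain ⟨T, hT⟩ := key
  obtain ⟨v₀⟩ := ‹Nonempty E›
  -- The extra point keeps the hull nonempty, which is what excludes `ζ = 0` as a separating vector.
  set T' : Finset E := insert v₀ T with hT'
  have hcomp : IsCompact (convexHull ℝ (g '' T')) :=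
    (T'.finite_toSet.image g).isCompact_convexHull ℝ
  refine convexHull_mono (Set.image_subset_range g T') ?_
  by_contra h0
  obtain ⟨ζ, u, h1, h2⟩ := exists_inner_lt_of_notMem (convex_convexHull ℝ _) hcomp.isClosed h0
  rw [inner_zero_right] at h1
  have hpos : ∀ v ∈ T', 0 < inner ℝ ζ (g v) := fun v hv =>
    h1.trans (h2 _ (subset_convexHull ℝ _ ⟨v, hv, rfl⟩))
  have hζ : ζ ≠ 0 := by
    rintro rfl
    simpa using hpos v₀ (by simp [hT'])
  obtain ⟨v, hv, hlt⟩ := hT (-(‖ζ‖⁻¹ • ζ)) (by simp [norm_smul, hζ])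
  rw [inner_neg_left, real_inner_smul_left] at hlt
  have := mul_nonneg (inv_nonneg.2 (norm_nonneg ζ)) (hpos v (by simp [hT', hv])).le
  linarith

end Duality

/-! ### Transport plans built from finitely many moves -/

section UpperBound

variable {m l r : ℕ} {q : ℝ≥0∞}
  {h : EuclideanSpace ℝ (Fin m) → EuclideanSpace ℝ (Fin l) → EuclideanSpace ℝ (Fin r)}
  {θ : EuclideanSpace ℝ (Fin l)} {n : ℕ} {w : ℕ → EuclideanSpace ℝ (Fin m)}

/-- The average of `f` over the first `n` sample points. -/
noncomputable def sampleMean {E G : Type*} [AddCommGroup G] [Module ℝ G] (n : ℕ) (w : ℕ → E) (f : E → G) : G :=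
  (n : ℝ)⁻¹ • ∑ i ∈ Finset.range n, f (w i)

/-- The change of `g` when a point `w ∈ B` is moved to `v`, and `0` for `w ∉ B`. -/
noncomputable def moveGain (g : EuclideanSpace ℝ (Fin m) → EuclideanSpace ℝ (Fin r))
    (j : Set (EuclideanSpace ℝ (Fin m)) × EuclideanSpace ℝ (Fin m)) :
    EuclideanSpace ℝ (Fin m) → EuclideanSpace ℝ (Fin r) :=
  j.1.indicator fun w => g j.2 - g w

/-- The cost of moving a point `w ∈ B` to `v`, and `0` for `w ∉ B`. -/
noncomputable def moveCost (q : ℝ≥0∞) (j : Set (EuclideanSpace ℝ (Fin m)) × EuclideanSpace ℝ (Fin m)) :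
    EuclideanSpace ℝ (Fin m) → ℝ :=
  j.1.indicator fun w => lqNorm q (j.2 - w)

/-- Every sample point is spread over the same finitely many points, with the weights that average
`h` to `0`. -/
lemma profile_ne_top [Fact (1 ≤ q)] (hn : 1 ≤ n)
    (h0 : (0 : EuclideanSpace ℝ (Fin r)) ∈ convexHull ℝ (Set.range fun v => h v θ)) :
    profile q 1 h n w θ ≠ ∞ := by
  obtain ⟨κ, _, b, z, hb0, hb1, hz, hbz⟩ := mem_convexHull_iff_exists_fintype.1 h0
  choose u hu using hz
  refine ne_top_of_le_ne_top ENNReal.ofReal_ne_top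
    (profile_le_of_splitting hn (fun _ k => b k) (fun _ => hb0) (fun _ => hb1) (fun _ k => u k) ?_)
  simp only at hu
  simp [hu, hbz]

/-- Moving a fraction `b j` of the sample points of a set to a common point, for each `j`. -/
lemma profile_le_of_moves [Fact (1 ≤ q)] (hn : 1 ≤ n) {J : Type*} [Fintype J]
    (s : J → Set (EuclideanSpace ℝ (Fin m)) × EuclideanSpace ℝ (Fin m)) (b : J → ℝ)
    (hb0 : ∀ j, 0 ≤ b j) (hb1 : ∑ j, b j ≤ 1)
    (hb : ∑ j, b j • sampleMean n w (moveGain (fun v => h v θ) (s j)) =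
      -sampleMean n w fun v => h v θ) :
    profile q 1 h n w θ ≤ ENNReal.ofReal (∑ j, b j * sampleMean n w (moveCost q (s j))) := by
  classical
  have hn0 : (n : ℝ)⁻¹ ≠ 0 := inv_ne_zero (by exact_mod_cast (by omega : n ≠ 0))
  set φ : ℕ → J → ℝ := fun i j => (s j).1.indicator 1 (w i) with hφ
  have hφ0 : ∀ i j, 0 ≤ φ i j := fun i j => Set.indicator_nonneg (by simp) _
  have hφ1 : ∀ i j, φ i j ≤ 1 := fun i j => Set.indicator_le_self' (by simp) _
  have hgain : ∀ i j, moveGain (fun v => h v θ) (s j) (w i) =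
      φ i j • (h (s j).2 θ - h (w i) θ) := fun i j => by
    by_cases hi : w i ∈ (s j).1 <;> simp [moveGain, hφ, hi]
  have hcost : ∀ i j, moveCost q (s j) (w i) = φ i j * lqNorm q ((s j).2 - w i) := fun i j => by
    by_cases hi : w i ∈ (s j).1 <;> simp [moveCost, hφ, hi]
  refine (profile_le_of_splitting (κ := Option J) hn
    -- The index `none` keeps at `w i` whatever mass the moves leave there.
    (fun i k => k.elim (1 - ∑ j, b j * φ i j) fun j => b j * φ i j) ?_ ?_
    (fun i k => k.elim (w i) fun j => (s j).2) ?_).trans (le_of_eq (congrArg _ ?_))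
  · rintro i (_ | j)
    · simp only [Option.elim_none, sub_nonneg]
      exact (Finset.sum_le_sum fun j _ => mul_le_of_le_one_right (hb0 j) (hφ1 i j)).trans hb1
    · exact mul_nonneg (hb0 j) (hφ0 i j)
  · intro i
    simp [Fintype.sum_option]
  · have hrow : ∀ i, ∑ k : Option J, (k.elim (1 - ∑ j, b j * φ i j) fun j => b j * φ i j) •
        h (k.elim (w i) fun j => (s j).2) θ =
        h (w i) θ + ∑ j, b j • moveGain (fun v => h v θ) (s j) (w i) := by
      intro i
      simp only [Fintype.sum_option, Option.elim_none, Option.elim_some, hgain, smul_sub, sub_smul,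
        one_smul, Finset.sum_sub_distrib, Finset.sum_smul, smul_smul]
      abel
    have hcomm : ∑ j, b j • sampleMean n w (moveGain (fun v => h v θ) (s j)) =
        (n : ℝ)⁻¹ • ∑ i ∈ Finset.range n, ∑ j, b j • moveGain (fun v => h v θ) (s j) (w i) := by
      rw [Finset.sum_comm, Finset.smul_sum]
      refine Finset.sum_congr rfl fun j _ => ?_
      rw [sampleMean, smul_comm, Finset.smul_sum]
    rw [hcomm, sampleMean, ← smul_neg] at hb
    rw [Finset.sum_congr rfl fun i _ => hrow i, Finset.sum_add_distrib,
      smul_right_injective _ hn0 hb, add_neg_cancel]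
  · simp only [Fintype.sum_option, Option.elim_none, Option.elim_some, sub_self, lqNorm_zero,
      mul_zero, zero_add, sampleMean, smul_eq_mul, hcost]
    rw [Finset.sum_comm, Finset.mul_sum]
    refine Finset.sum_congr rfl fun j _ => ?_
    simp only [mul_assoc, ← Finset.mul_sum]
    rw [mul_left_comm]

lemma inner_le_supLinear_add {A : Set (EuclideanSpace ℝ (Fin r))} (hA : IsCompact A)
    (hne : A.Nonempty) {ε : ℝ} {ζ : EuclideanSpace ℝ (Fin r)} (hζ : Metric.infDist ζ A < ε)
    (x : EuclideanSpace ℝ (Fin r)) : inner ℝ ζ x ≤ supLinear A x + ε * ‖x‖ := by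
  obtain ⟨z, hz, hd⟩ := (Metric.infDist_lt_iff hne).1 hζ
  have h1 : inner ℝ ζ x = inner ℝ z x + inner ℝ (ζ - z) x := by rw [inner_sub_left]; ring
  have h2 : inner ℝ (ζ - z) x ≤ ε * ‖x‖ := (real_inner_le_norm _ _).trans
    (mul_le_mul_of_nonneg_right (by rw [← dist_eq_norm]; exact hd.le) (norm_nonneg _))
  linarith [inner_le_supLinear hA hz x]

/-- Dual feasible vectors stay `ε`-close to `A` because they avoid the shell, so the value of the
linear program is at most `S(x) + ε‖x‖`. The lower bound `c₀` on the costs turns this into total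
fraction at most `1`. -/
lemma profile_le_supLinear_add [Fact (1 ≤ q)] (hn : 1 ≤ n) {J : Type*} [Fintype J]
    (s : J → Set (EuclideanSpace ℝ (Fin m)) × EuclideanSpace ℝ (Fin m))
    {A : Set (EuclideanSpace ℝ (Fin r))} (hA : IsCompact A) (hA0 : 0 ∈ A) {ε c₀ : ℝ} (hε : 0 < ε)
    (hc₀ : 0 < c₀) (hc : ∀ j, c₀ ≤ sampleMean n w (moveCost q (s j)))
    (hsmall : supLinear A (-sampleMean n w fun v => h v θ) +
      ε * ‖-sampleMean n w fun v => h v θ‖ ≤ c₀)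
    (hshell : ∀ ζ ∈ {ζ | Metric.infDist ζ A = ε}, ∃ j, sampleMean n w (moveCost q (s j)) <
      inner ℝ ζ (sampleMean n w (moveGain (fun v => h v θ) (s j)))) :
    profile q 1 h n w θ ≤ ENNReal.ofReal (supLinear A (-sampleMean n w fun v => h v θ) +
      ε * ‖-sampleMean n w fun v => h v θ‖) := by
  set x := -sampleMean n w fun v => h v θ with hx
  set t := supLinear A x + ε * ‖x‖ with ht
  set a := fun j => sampleMean n w (moveGain (fun v => h v θ) (s j)) with ha
  set c := fun j => sampleMean n w (moveCost q (s j)) with hcdef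
  have hS0 : 0 ≤ supLinear A x := by simpa using inner_le_supLinear hA hA0 x
  suffices ∃ b : J → ℝ, (∀ j, 0 ≤ b j) ∧ ∑ j, b j • a j = x ∧ ∑ j, b j * c j ≤ t by
    obtain ⟨b, hb0, hbx, hbt⟩ := this
    refine (profile_le_of_moves hn s b hb0 ?_ hbx).trans (ENNReal.ofReal_le_ofReal hbt)
    have h1 : (∑ j, b j) * c₀ ≤ ∑ j, b j * c j := by
      rw [Finset.sum_mul]
      exact Finset.sum_le_sum fun j _ => mul_le_mul_of_nonneg_left (hc j) (hb0 j)
    exact le_of_mul_le_mul_right (by linarith) hc₀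
  -- Duality needs a positive budget; for `x = 0` no move is made.
  rcases eq_or_ne x 0 with hx0 | hx0
  · exact ⟨0, by simp, by simp [hx0], by simp; positivity⟩
  · have hcpos : ∀ j, 0 < c j := fun j => hc₀.trans_le (hc j)
    refine exists_nonneg_combination hcpos (by have := norm_pos_iff.2 hx0; positivity)
      fun ζ hζ => inner_le_supLinear_add hA ⟨0, hA0⟩ ?_ x
    refine infDist_lt_of_disjoint_shell (C := {ζ | ∀ j, inner ℝ ζ (a j) ≤ c j}) hA0 ?_
      (fun j => by simpa using (hcpos j).le) hε ?_ hζ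
    · intro z hz y hy α β hα hβ hαβ j
      rw [inner_add_left, real_inner_smul_left, real_inner_smul_left]
      have h1 := mul_le_mul_of_nonneg_left (hz j) hα
      have h2 := mul_le_mul_of_nonneg_left (hy j) hβ
      have h3 : α * c j + β * c j = c j := by rw [← add_mul, hαβ, one_mul]
      linarith
    · intro z hz hzε
      obtain ⟨j, hj⟩ := hshell z hzε
      exact absurd (hz j) (not_le.2 hj)

end UpperBound

end RWP

namespace RWP

/-! ### Multivariate central limit theorem -/

section CentralLimit

variable {r : ℕ} {Ω : Type*} [MeasurableSpace Ω] {μ : Measure Ω}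
  {V : Ω → EuclideanSpace ℝ (Fin r)} {S : Matrix (Fin r) (Fin r) ℝ}

lemma memLp_inner {t : EuclideanSpace ℝ (Fin r)} (hV : MemLp V 2 μ) :
    MemLp (fun ω => inner ℝ (V ω) t) 2 μ :=
  hV.inner_const t

lemma integral_inner_sq_eq_dotProduct (hV : MemLp V 2 μ)
    (hS : ∀ i j, S i j = ∫ ω, V ω i * V ω j ∂μ) (t : EuclideanSpace ℝ (Fin r)) :
    ∫ ω, inner ℝ (V ω) t ^ 2 ∂μ = t.ofLp ⬝ᵥ S.mulVec t.ofLp := by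
  have hcoord : ∀ i, MemLp (fun ω => V ω i) 2 μ := fun i => by
    simpa [EuclideanSpace.inner_single_right] using
      memLp_inner (t := EuclideanSpace.single i 1) hV
  have hint : ∀ i j, Integrable (fun ω => t i * t j * (V ω i * V ω j)) μ := fun i j =>
    ((hcoord i).integrable_mul (hcoord j)).const_mul _
  have h1 : ∀ ω, inner ℝ (V ω) t ^ 2 = ∑ i, ∑ j, t i * t j * (V ω i * V ω j) := by
    intro ω
    rw [inner_eq_sum, sq, Finset.sum_mul_sum]
    exact Finset.sum_congr rfl fun i _ => Finset.sum_congr rfl fun j _ => by ring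
  simp only [h1]
  rw [integral_finsetSum _ fun i _ => integrable_finsetSum _ fun j _ => hint i j]
  simp only [dotProduct, Matrix.mulVec, Finset.mul_sum]
  refine Finset.sum_congr rfl fun i _ => ?_
  rw [integral_finsetSum _ fun j _ => hint i j]
  refine Finset.sum_congr rfl fun j _ => ?_
  rw [integral_const_mul, hS]
  ring

lemma posSemidef_of_second_moments (hV : MemLp V 2 μ)
    (hS : ∀ i j, S i j = ∫ ω, V ω i * V ω j ∂μ) : S.PosSemidef := by
  refine Matrix.PosSemidef.of_dotProduct_mulVec_nonneg ?_ fun x => ?_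
  · ext i j
    simp [hS, mul_comm]
  · have := integral_inner_sq_eq_dotProduct hV hS (WithLp.toLp 2 x)
    rw [star_trivial, ← this]
    exact integral_nonneg fun ω => sq_nonneg _

/-- The Cramér–Wold reduction to one-dimensional projections. -/
lemma charFun_map_inner {ν : Measure Ω} {X : Ω → EuclideanSpace ℝ (Fin r)} (hX : AEMeasurable X ν)
    (t : EuclideanSpace ℝ (Fin r)) :
    charFun (ν.map X) t = charFun (ν.map fun ω => inner ℝ (X ω) t) 1 := by
  rw [charFun_apply, charFun_apply, integral_map hX, integral_map]
  · simp
  · fun_prop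
  · fun_prop
  · fun_prop

/-- The multivariate central limit theorem for centered i.i.d. random vectors. -/
theorem tendstoInDistribution_multivariateGaussian [IsProbabilityMeasure μ]
    {Ω' : Type*} [MeasurableSpace Ω'] {μ' : Measure Ω'} [IsProbabilityMeasure μ']
    {X : ℕ → Ω → EuclideanSpace ℝ (Fin r)} (hindep : iIndepFun X μ)
    (hident : ∀ i, IdentDistrib (X i) V μ μ) (hV : MemLp V 2 μ) (hmean : ∫ ω, V ω ∂μ = 0)
    (hS : ∀ i j, S i j = ∫ ω, V ω i * V ω j ∂μ) {H : Ω' → EuclideanSpace ℝ (Fin r)}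
    (hH : HasLaw H (multivariateGaussian 0 S) μ') :
    TendstoInDistribution (fun (n : ℕ) ω => (√n)⁻¹ • ∑ i ∈ Finset.range n, X i ω) atTop H
      (fun _ => μ) μ' := by
  have hX : ∀ i, AEMeasurable (X i) μ := fun i => (hident i).aemeasurable_fst
  have hmeas : ∀ n : ℕ, AEMeasurable (fun ω => (√n)⁻¹ • ∑ i ∈ Finset.range n, X i ω) μ := fun n =>
    (Finset.aemeasurable_fun_sum (Finset.range n) fun i _ => hX i).const_smul (√n)⁻¹
  refine ⟨hmeas, hH.aemeasurable, ?_⟩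
  refine ProbabilityMeasure.tendsto_iff_tendsto_charFun.2 fun t => ?_
  have hφ : Measurable fun x : EuclideanSpace ℝ (Fin r) => inner ℝ x t := by fun_prop
  have hid : ∀ i, IdentDistrib (fun ω => inner ℝ (X i ω) t) (fun ω => inner ℝ (V ω) t) μ μ :=
    fun i => (hident i).comp hφ
  have hmean' : ∫ ω, inner ℝ (V ω) t ∂μ = 0 := by
    simp only [real_inner_comm t]
    rw [integral_inner (hV.integrable one_le_two), hmean, inner_zero_right]
  have hint0 : ∫ ω, inner ℝ (X 0 ω) t ∂μ = 0 := by rw [(hid 0).integral_eq, hmean']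
  have hvar : Var[fun ω => inner ℝ (X 0 ω) t; μ] = t.ofLp ⬝ᵥ S.mulVec t.ofLp := by
    rw [(hid 0).variance_eq, variance_of_integral_eq_zero (hid 0).aemeasurable_snd hmean']
    exact integral_inner_sq_eq_dotProduct hV hS t
  have hclt := tendstoInDistribution_inv_sqrt_mul_sum_sub (P := μ)
    (X := fun i ω => inner ℝ (X i ω) t)
    (HasLaw.id (μ := gaussianReal 0 Var[fun ω => inner ℝ (X 0 ω) t; μ].toNNReal))
    ((hid 0).memLp_iff.2 (memLp_inner hV)) (hindep.comp _ fun _ => hφ)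
    (fun i => (hid i).trans (hid 0).symm)
  have h1 := ProbabilityMeasure.tendsto_iff_tendsto_charFun.1 hclt.tendsto 1
  simp only [ProbabilityMeasure.coe_mk] at h1 ⊢
  convert h1 using 2 with n
  · rw [charFun_map_inner (hmeas n)]
    congr 2 with ω
    rw [hint0, mul_zero, sub_zero, real_inner_smul_left, sum_inner]
  · rw [hH.map_eq, charFun_multivariateGaussian (posSemidef_of_second_moments hV hS), Measure.map_id,
      charFun_gaussianReal, hvar, Real.coe_toNNReal]
    · simp
    · rw [← integral_inner_sq_eq_dotProduct hV hS t]
      exact integral_nonneg fun ω => sq_nonneg _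

end CentralLimit

/-! ### Averages of moves, and moves that detect non-Lipschitz directions -/

section LawOfLargeNumbers

variable {m r : ℕ} {q : ℝ≥0∞} {Ω : Type*} [MeasurableSpace Ω] {μ : Measure Ω}
  {W : Ω → EuclideanSpace ℝ (Fin m)} {Ws : ℕ → Ω → EuclideanSpace ℝ (Fin m)}

lemma ae_tendsto_sampleMean {G : Type*} [NormedAddCommGroup G] [NormedSpace ℝ G] [CompleteSpace G]
    [MeasurableSpace G] [BorelSpace G] [SecondCountableTopology G]
    (hindep : iIndepFun Ws μ) (hident : ∀ i, IdentDistrib (Ws i) W μ μ)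
    {f : EuclideanSpace ℝ (Fin m) → G} (hf : Measurable f) (hint : Integrable f (μ.map W)) :
    ∀ᵐ ω ∂μ, Tendsto (fun n => sampleMean n (fun i => Ws i ω) f) atTop (𝓝 (∫ w, f w ∂(μ.map W))) := by
  have hid : ∀ i, IdentDistrib (fun ω => f (Ws i ω)) (fun ω => f (W ω)) μ μ :=
    fun i => (hident i).comp hf
  have hW : AEMeasurable W μ := (hident 0).aemeasurable_snd
  have hi : Integrable (fun ω => f (W ω)) μ :=
    (integrable_map_measure hf.aestronglyMeasurable hW).1 hint
  have h := strong_law_ae (μ := μ) (fun i ω => f (Ws i ω)) ((hid 0).integrable_iff.2 hi)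
    (fun i j hij => (hindep.comp _ fun _ => hf).indepFun hij) fun i => (hid i).trans (hid 0).symm
  rwa [(hid 0).integral_eq, ← integral_map hW hf.aestronglyMeasurable] at h

variable {g : EuclideanSpace ℝ (Fin m) → EuclideanSpace ℝ (Fin r)}
  {ν : Measure (EuclideanSpace ℝ (Fin m))}

lemma measurable_moveGain (hg : Continuous g)
    {j : Set (EuclideanSpace ℝ (Fin m)) × EuclideanSpace ℝ (Fin m)} (hj : MeasurableSet j.1) :
    Measurable (moveGain g j) :=
  (continuous_const.sub hg).measurable.indicator hj

lemma measurable_moveCost [Fact (1 ≤ q)]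
    {j : Set (EuclideanSpace ℝ (Fin m)) × EuclideanSpace ℝ (Fin m)} (hj : MeasurableSet j.1) :
    Measurable (moveCost q j) :=
  (continuous_lqNorm.comp (continuous_const.sub continuous_id)).measurable.indicator hj

lemma integrableOn_of_isBounded {G : Type*} [NormedAddCommGroup G] [IsFiniteMeasure ν]
    {f : EuclideanSpace ℝ (Fin m) → G} (hf : Continuous f) {B : Set (EuclideanSpace ℝ (Fin m))}
    (hB : Bornology.IsBounded B) : IntegrableOn f B ν :=
  (hf.continuousOn.integrableOn_compact hB.isCompact_closure).mono_set subset_closure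

/-- A vector `ζ` for which `ζᵀ g` is not `1`-Lipschitz is detected by moving the mass of a ball. -/
lemma exists_move_of_notMem_lipSet [Fact (1 ≤ q)] [IsFiniteMeasure ν] [ν.IsOpenPosMeasure]
    (hg : Continuous g) {ζ : EuclideanSpace ℝ (Fin r)} (hζ : ζ ∉ lipSet q g) :
    ∃ j : Set (EuclideanSpace ℝ (Fin m)) × EuclideanSpace ℝ (Fin m),
      MeasurableSet j.1 ∧ Bornology.IsBounded j.1 ∧ 0 < ∫ w, moveCost q j w ∂ν ∧
        ∫ w, moveCost q j w ∂ν < inner ℝ ζ (∫ w, moveGain g j w ∂ν) := by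
  simp only [lipSet, Set.mem_ofPred_eq, not_forall, not_le] at hζ
  obtain ⟨u, w₀, hu⟩ := hζ
  have hcq : Continuous fun w => lqNorm q (u - w) :=
    continuous_lqNorm.comp (continuous_const.sub continuous_id)
  have hcg : Continuous fun w => g u - g w := continuous_const.sub hg
  have hci : Continuous fun w => inner ℝ ζ (g u - g w) - lqNorm q (u - w) :=
    (continuous_const.inner hcg).sub hcq
  -- The violated inequality is strict, so it persists for starting points in a ball, which has
  -- positive mass.
  obtain ⟨δ, hδ, hball⟩ := Metric.isOpen_iff.1 (isOpen_lt hcq (continuous_const.inner hcg)) w₀ hu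
  have hpos : ∀ w ∈ Metric.ball w₀ δ, lqNorm q (u - w) < inner ℝ ζ (g u - g w) :=
    fun w hw => hball hw
  have hmeas : MeasurableSet (Metric.ball w₀ δ) := measurableSet_ball
  have hbdd : Bornology.IsBounded (Metric.ball w₀ δ) := Metric.isBounded_ball
  have hint : ∀ {f : EuclideanSpace ℝ (Fin m) → ℝ}, Continuous f →
      (∀ w ∈ Metric.ball w₀ δ, 0 < f w) → 0 < ∫ w in Metric.ball w₀ δ, f w ∂ν := by
    intro f hf hf0
    rw [setIntegral_pos_iff_support_of_nonneg_ae
      ((ae_restrict_iff' hmeas).2 (ae_of_all _ fun w hw => (hf0 w hw).le))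
      (integrableOn_of_isBounded hf hbdd)]
    refine (Metric.isOpen_ball.measure_pos ν (Metric.nonempty_ball.2 hδ)).trans_le
      (measure_mono fun w hw => ⟨(hf0 w hw).ne', hw⟩)
  refine ⟨(Metric.ball w₀ δ, u), hmeas, hbdd, ?_, ?_⟩
  · rw [moveCost, integral_indicator hmeas]
    refine hint hcq fun w hw => lqNorm_pos (sub_ne_zero.2 ?_)
    -- The target is outside the ball: at `w = u` both sides vanish and the strict inequality fails.
    rintro rfl
    simpa [lqNorm_zero] using hpos u hw
  · rw [moveCost, moveGain, integral_indicator hmeas, integral_indicator hmeas, ← sub_pos,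
      ← integral_inner (integrableOn_of_isBounded hcg hbdd), ← integral_sub
        (integrableOn_of_isBounded (continuous_const.inner hcg) hbdd)
        (integrableOn_of_isBounded hcq hbdd)]
    exact hint hci fun w hw => sub_pos.2 (hpos w hw)

/-- A move detecting `ζ` also detects all nearby vectors, so compactness leaves finitely many. -/
lemma exists_finset_moves [Fact (1 ≤ q)] [IsFiniteMeasure ν] [ν.IsOpenPosMeasure]
    (hg : Continuous g) {K : Set (EuclideanSpace ℝ (Fin r))} (hK : IsCompact K)
    (hdisj : ∀ ζ ∈ K, ζ ∉ lipSet q g) :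
    ∃ J : Finset (Set (EuclideanSpace ℝ (Fin m)) × EuclideanSpace ℝ (Fin m)),
      (∀ j ∈ J, MeasurableSet j.1 ∧ Bornology.IsBounded j.1 ∧ 0 < ∫ w, moveCost q j w ∂ν) ∧
        ∀ ζ ∈ K, ∃ j ∈ J, ∫ w, moveCost q j w ∂ν < inner ℝ ζ (∫ w, moveGain g j w ∂ν) := by
  classical
  refine hK.induction_on (p := fun s => ∃ J : Finset (Set (EuclideanSpace ℝ (Fin m)) ×
      EuclideanSpace ℝ (Fin m)),
      (∀ j ∈ J, MeasurableSet j.1 ∧ Bornology.IsBounded j.1 ∧ 0 < ∫ w, moveCost q j w ∂ν) ∧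
        ∀ ζ ∈ s, ∃ j ∈ J, ∫ w, moveCost q j w ∂ν < inner ℝ ζ (∫ w, moveGain g j w ∂ν))
    ⟨∅, by simp, by simp⟩ ?_ ?_ ?_
  · rintro s t hst ⟨J, hJ, hJ'⟩
    exact ⟨J, hJ, fun ζ hζ => hJ' ζ (hst hζ)⟩
  · rintro s t ⟨J₁, h₁, h₁'⟩ ⟨J₂, h₂, h₂'⟩
    refine ⟨J₁ ∪ J₂, fun j hj => (Finset.mem_union.1 hj).elim (h₁ j) (h₂ j), ?_⟩
    rintro ζ (hζ | hζ)
    · obtain ⟨j, hj, hlt⟩ := h₁' ζ hζ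
      exact ⟨j, Finset.mem_union_left _ hj, hlt⟩
    · obtain ⟨j, hj, hlt⟩ := h₂' ζ hζ
      exact ⟨j, Finset.mem_union_right _ hj, hlt⟩
  · intro ζ hζ
    obtain ⟨j, hj1, hj2, hj3, hj4⟩ := exists_move_of_notMem_lipSet (ν := ν) hg (hdisj ζ hζ)
    exact ⟨{z | ∫ w, moveCost q j w ∂ν < inner ℝ z (∫ w, moveGain g j w ∂ν)},
      mem_nhdsWithin_of_mem_nhds ((isOpen_lt continuous_const (by fun_prop)).mem_nhds hj4),
      {j}, by simp [hj1, hj2, hj3], by simp⟩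

end LawOfLargeNumbers

/-! ### Almost sure upper bound -/

section Asymptotics

variable {m l r : ℕ} {q : ℝ≥0∞} {Ω : Type*} [MeasurableSpace Ω] {μ : Measure Ω}
  [IsProbabilityMeasure μ]
  {W : Ω → EuclideanSpace ℝ (Fin m)} {Ws : ℕ → Ω → EuclideanSpace ℝ (Fin m)}
  {h : EuclideanSpace ℝ (Fin m) → EuclideanSpace ℝ (Fin l) → EuclideanSpace ℝ (Fin r)}
  {θ : EuclideanSpace ℝ (Fin l)}

/-- Almost surely, the profile is eventually within `ε |E_n[h]|` of its dual lower bound. -/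
lemma ae_eventually_profile_le [Fact (1 ≤ q)] (hindep : iIndepFun Ws μ)
    (hident : ∀ i, IdentDistrib (Ws i) W μ μ) [(μ.map W).IsOpenPosMeasure]
    (hcont : Continuous fun v => h v θ) (hint : Integrable (fun ω => h (W ω) θ) μ)
    (hmean : ∫ ω, h (W ω) θ ∂μ = 0) (hA : IsCompact (lipSet q fun v => h v θ)) {ε : ℝ}
    (hε : 0 < ε) :
    ∀ᵐ ω ∂μ, ∀ᶠ n : ℕ in atTop, profile q 1 h n (fun i => Ws i ω) θ ≤ ENNReal.ofReal
      (supLinear (lipSet q fun v => h v θ) (-sampleMean n (fun i => Ws i ω) fun v => h v θ) +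
        ε * ‖-sampleMean n (fun i => Ws i ω) fun v => h v θ‖) := by
  set A := lipSet q fun v => h v θ with hAdef
  have hA0 : (0 : EuclideanSpace ℝ (Fin r)) ∈ A := zero_mem_lipSet
  have hW : AEMeasurable W μ := (hident 0).aemeasurable_snd
  have : IsProbabilityMeasure (μ.map W) := Measure.isProbabilityMeasure_map hW
  set K := {ζ | Metric.infDist ζ A = ε} with hKdef
  have hK : IsCompact K := by
    refine (hA.cthickening (r := ε + 1)).of_isClosed_subset
      (isClosed_eq (Metric.continuous_infDist_pt A) continuous_const) fun ζ hζ => ?_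
    have hζ : Metric.infDist ζ A = ε := hζ
    exact Metric.thickening_subset_cthickening (ε + 1) A
      ((Metric.mem_thickening_iff_infDist_lt ⟨0, hA0⟩).2 (by linarith))
  have hKA : ∀ ζ ∈ K, ζ ∉ A := by
    intro ζ hζ hmem
    have hζ : Metric.infDist ζ A = ε := hζ
    rw [Metric.infDist_zero_of_mem hmem] at hζ
    exact hε.ne hζ
  obtain ⟨J, hJ, hJK⟩ := exists_finset_moves (q := q) (ν := μ.map W) hcont hK hKA
  have hgain : ∀ᵐ ω ∂μ, ∀ j : J, Tendsto (fun n => sampleMean n (fun i => Ws i ω)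
      (moveGain (fun v => h v θ) j)) atTop (𝓝 (∫ w, moveGain (fun v => h v θ) j w ∂(μ.map W))) := by
    refine ae_all_iff.2 fun j => ?_
    obtain ⟨h1, h2, -⟩ := hJ j j.2
    exact ae_tendsto_sampleMean hindep hident (measurable_moveGain hcont h1)
      ((integrableOn_of_isBounded (continuous_const.sub hcont) h2).integrable_indicator h1)
  have hcost : ∀ᵐ ω ∂μ, ∀ j : J, Tendsto (fun n => sampleMean n (fun i => Ws i ω)
      (moveCost q j)) atTop (𝓝 (∫ w, moveCost q j w ∂(μ.map W))) := by
    refine ae_all_iff.2 fun j => ?_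
    obtain ⟨h1, h2, -⟩ := hJ j j.2
    exact ae_tendsto_sampleMean hindep hident (measurable_moveCost h1)
      ((integrableOn_of_isBounded (continuous_lqNorm.comp (continuous_const.sub continuous_id))
        h2).integrable_indicator h1)
  have hzero : ∀ᵐ ω ∂μ, Tendsto (fun n => sampleMean n (fun i => Ws i ω) fun v => h v θ) atTop
      (𝓝 0) := by
    have := ae_tendsto_sampleMean hindep hident hcont.measurable
      ((integrable_map_measure hcont.aestronglyMeasurable hW).2 hint)
    rwa [integral_map hW hcont.aestronglyMeasurable, hmean] at this
  -- Choosing `c₀` near `0` from the right also covers an empty family of moves.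
  obtain ⟨c₀, hc₀, hc₀J⟩ : ∃ c₀ : ℝ, 0 < c₀ ∧ ∀ j : J, c₀ < ∫ w, moveCost q j w ∂(μ.map W) := by
    have h1 : ∀ᶠ c₀ in 𝓝[>] (0 : ℝ), ∀ j : J, c₀ < ∫ w, moveCost q j w ∂(μ.map W) :=
      eventually_all.2 fun j =>
        mem_nhdsWithin_of_mem_nhds (isOpen_Iio.mem_nhds (hJ j j.2).2.2)
    obtain ⟨c₀, h2, h3⟩ := (h1.and self_mem_nhdsWithin).exists
    exact ⟨c₀, h3, h2⟩
  filter_upwards [hgain, hcost, hzero] with ω hg hc hz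
  have hlim := (tendsto_pi_nhds.2 hg).prodMk_nhds (tendsto_pi_nhds.2 hc)
  have hshell := hlim.eventually (eventually_forall_exists_lt_inner hK
    (a := fun j : J => ∫ w, moveGain (fun v => h v θ) j w ∂(μ.map W))
    (c := fun j : J => ∫ w, moveCost q j w ∂(μ.map W)) fun ζ hζ => by
      obtain ⟨j, hj, hlt⟩ := hJK ζ hζ
      exact ⟨⟨j, hj⟩, hlt⟩)
  have hcbd : ∀ᶠ n in atTop, ∀ j : J, c₀ < sampleMean n (fun i => Ws i ω) (moveCost q j) :=
    eventually_all.2 fun j => (hc j).eventually_const_lt (hc₀J j)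
  have hsmall : ∀ᶠ n in atTop,
      supLinear A (-sampleMean n (fun i => Ws i ω) fun v => h v θ) +
        ε * ‖-sampleMean n (fun i => Ws i ω) fun v => h v θ‖ < c₀ := by
    have hcontS : Continuous fun x => supLinear A (-x) + ε * ‖-x‖ :=
      ((continuous_supLinear hA).comp continuous_neg).add (by fun_prop)
    have h1 := (hcontS.tendsto 0).comp hz
    have h2 : supLinear A 0 = 0 := by
      simpa using supLinear_smul_of_nonneg le_rfl hA ⟨0, hA0⟩ 0
    simp only [neg_zero, norm_zero, mul_zero, add_zero, h2] at h1
    exact h1.eventually_lt_const hc₀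
  filter_upwards [hshell, hcbd, hsmall, eventually_ge_atTop 1] with n h1 h2 h3 h4
  exact profile_le_supLinear_add h4 (fun j : J => (j : Set _ × _)) hA hA0 hε hc₀
    (fun j => (h2 j).le) h3.le h1

end Asymptotics

end RWP

namespace RWP

/-! ### Consequences of nondegeneracy -/

section Nondegeneracy

variable {m l r : ℕ} {p : ℝ≥0∞} {Ω : Type*} [MeasurableSpace Ω] {μ : Measure Ω}
  {W : Ω → EuclideanSpace ℝ (Fin m)}
  {h : EuclideanSpace ℝ (Fin m) → EuclideanSpace ℝ (Fin l) → EuclideanSpace ℝ (Fin r)}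
  {θ : EuclideanSpace ℝ (Fin l)}

/-- Otherwise, exchanging `u` and `w` shows that `ζᵀh` is constant, and its gradient vanishes
everywhere. -/
lemma exists_inner_sub_pos [Fact (1 ≤ p)] (hdiff : ContDiff ℝ 1 fun w => h w θ)
    {ζ : EuclideanSpace ℝ (Fin r)} (hζ : 0 < μ {ω | 0 < lqNorm p (rowDeriv h θ ζ (W ω))}) :
    ∃ u w, 0 < inner ℝ ζ (h u θ - h w θ) := by
  by_contra! hle
  obtain ⟨ω, hω⟩ := nonempty_of_measure_ne_zero hζ.ne'
  refine (show 0 < lqNorm p (rowDeriv h θ ζ (W ω)) from hω).ne' ?_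
  have hrow : rowDeriv h θ ζ (W ω) = 0 := by
    refine ext_inner_right ℝ fun y => ?_
    have h1 := hasDerivAt_inner_segment (hdiff.differentiable one_ne_zero) ζ (W ω) y 0
    have hconst : (fun t : ℝ => inner ℝ ζ (h (W ω + t • y) θ)) = fun _ => inner ℝ ζ (h (W ω) θ) := by
      funext t
      have h2 := hle (W ω + t • y) (W ω)
      have h3 := hle (W ω) (W ω + t • y)
      rw [inner_sub_right] at h2 h3
      linarith
    rw [hconst] at h1
    rw [inner_zero_left, inner_rowDeriv]
    simpa using h1.unique (hasDerivAt_const 0 _)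
  rw [hrow, lqNorm_zero]

/-- A continuous nonpositive function of mean zero vanishes almost surely, hence everywhere by full
support, so it cannot be nonconstant. This puts `0` in the convex hull of the values of `h`. -/
lemma exists_inner_pos (hcont : Continuous fun w => h w θ) (hW : AEMeasurable W μ)
    [(μ.map W).IsOpenPosMeasure] (hint : Integrable (fun ω => h (W ω) θ) μ)
    (hmean : ∫ ω, h (W ω) θ ∂μ = 0) {ζ : EuclideanSpace ℝ (Fin r)}
    (hζ : ∃ u w, 0 < inner ℝ ζ (h u θ - h w θ)) : ∃ v, 0 < inner ℝ ζ (h v θ) := by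
  by_contra! hle
  have hci : Continuous fun v => inner ℝ ζ (h v θ) := continuous_const.inner hcont
  have h0 : ∫ ω, -inner ℝ ζ (h (W ω) θ) ∂μ = 0 := by
    rw [integral_neg, integral_inner hint, hmean, inner_zero_right, neg_zero]
  rw [integral_eq_zero_iff_of_nonneg (fun ω => neg_nonneg.2 (hle _)) (hint.const_inner ζ).neg] at h0
  have hopen : IsOpen {v | inner ℝ ζ (h v θ) ≠ 0} := isOpen_ne_fun hci continuous_const
  have hnull : μ.map W {v | inner ℝ ζ (h v θ) ≠ 0} = 0 := by
    rw [Measure.map_apply_of_aemeasurable hW hopen.measurableSet]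
    refine measure_mono_null (fun ω hω => ?_) (ae_iff.1 h0)
    simpa using hω
  rw [hopen.measure_eq_zero_iff (μ.map W), Set.eq_empty_iff_forall_notMem] at hnull
  obtain ⟨u, w, huw⟩ := hζ
  have hu := hnull u
  have hw := hnull w
  simp only [ne_eq, Set.mem_ofPred_eq, not_not] at hu hw
  rw [inner_sub_right, hu, hw] at huw
  simp at huw

end Nondegeneracy

end RWP

/-! ### Squeeze and passage to the limit -/

theorem mainTheorem3 {m l r : ℕ}
    {Ω : Type*} [MeasurableSpace Ω] (μ : Measure Ω) [IsProbabilityMeasure μ]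
    {Ω' : Type*} [MeasurableSpace Ω'] (μ' : Measure Ω') [IsProbabilityMeasure μ']
    (h : EuclideanSpace ℝ (Fin m) → EuclideanSpace ℝ (Fin l) → EuclideanSpace ℝ (Fin r))
    (θ : EuclideanSpace ℝ (Fin l))
    -- the random vector `W` and its i.i.d. copies
    (W : Ω → EuclideanSpace ℝ (Fin m)) (Ws : ℕ → Ω → EuclideanSpace ℝ (Fin m))
    (hindep : iIndepFun Ws μ) (hident : ∀ i, IdentDistrib (Ws i) W μ μ)
    -- A1
    (p q : ℝ≥0∞) (hq : 1 ≤ q) (hpq : 1 / p + 1 / q = 1)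
    -- A2
    (hL2 : MemLp (fun ω => h (W ω) θ) 2 μ) (hmean : ∫ ω, h (W ω) θ ∂μ = 0)
    -- A3
    (hdiff : ContDiff ℝ 1 (fun w => h w θ))
    -- A4
    (hnondeg : ∀ ζ : EuclideanSpace ℝ (Fin r), ζ ≠ 0 →
      0 < μ {ω | 0 < RWP.lqNorm p (RWP.rowDeriv h θ ζ (W ω))})
    -- `W` has an almost everywhere positive Lebesgue density
    (hpdf : HasPDF W μ volume) (hpos : ∀ᵐ w ∂(volume : Measure (EuclideanSpace ℝ (Fin m))),
      0 < pdf W μ volume w)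
    -- the Gaussian vector `H`
    (H : Ω' → EuclideanSpace ℝ (Fin r))
    (hH : HasLaw H (multivariateGaussian 0 (RWP.covMatrix μ h θ W)) μ') :
    -- `R_n` is finite
    (∀ n : ℕ, 1 ≤ n → ∀ ω, RWP.profile q 1 h n (fun i => Ws i ω) θ ≠ ∞) ∧
    -- the supremum defining the limit is a maximum
    (∀ x : EuclideanSpace ℝ (Fin r),
      IsGreatest ((fun ζ => inner ℝ ζ x) '' RWP.dualSet μ p h θ W)
        (RWP.supLinear (RWP.dualSet μ p h θ W) x)) ∧
    TendstoInDistribution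
      (fun (n : ℕ) ω => Real.sqrt n * (RWP.profile q 1 h n (fun i => Ws i ω) θ).toReal)
      atTop
      (fun ω' => RWP.supLinear (RWP.dualSet μ p h θ W) (H ω'))
      (fun _ => μ) μ' := by
  have : Fact (1 ≤ q) := ⟨hq⟩
  have hc : ENNReal.HolderConjugate p q := ⟨by simpa using hpq⟩
  have : Fact (1 ≤ p) := ⟨ENNReal.HolderConjugate.one_le p q⟩
  have hW : AEMeasurable W μ := HasPDF.aemeasurable W μ volume
  have hcont : Continuous fun w => h w θ := hdiff.continuous
  have : (μ.map W).IsOpenPosMeasure := RWP.isOpenPosMeasure_map_of_pdf_pos hpos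
  have hint : Integrable (fun ω => h (W ω) θ) μ := hL2.integrable one_le_two
  have hsub : ∀ ζ : EuclideanSpace ℝ (Fin r), ζ ≠ 0 → ∃ u w, 0 < inner ℝ ζ (h u θ - h w θ) :=
    fun ζ hζ => RWP.exists_inner_sub_pos hdiff (hnondeg ζ hζ)
  have hdual : RWP.dualSet μ p h θ W = RWP.lipSet q fun w => h w θ :=
    RWP.dualSet_eq_lipSet hpq hdiff hW
  rw [hdual]
  set A := RWP.lipSet q fun w => h w θ with hAdef
  have hA : IsCompact A := RWP.isCompact_lipSet hsub
  have hA0 : A.Nonempty := ⟨0, RWP.zero_mem_lipSet⟩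
  have hSneg := RWP.supLinear_neg hA hA0 fun ζ hζ => RWP.neg_mem_lipSet hζ
  have hfin : ∀ n : ℕ, 1 ≤ n → ∀ w : ℕ → EuclideanSpace ℝ (Fin m),
      RWP.profile q 1 h n w θ ≠ ∞ := fun n hn w =>
    RWP.profile_ne_top hn (RWP.zero_mem_convexHull_range fun ζ hζ =>
      RWP.exists_inner_pos hcont hW hint hmean (hsub ζ hζ))
  refine ⟨fun n hn ω => hfin n hn _, fun x => RWP.isGreatest_supLinear hA hA0 x, ?_⟩
  set X : ℕ → Ω → EuclideanSpace ℝ (Fin r) :=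
    fun n ω => (√n)⁻¹ • ∑ i ∈ Finset.range n, h (Ws i ω) θ with hX
  set Y : ℕ → Ω → ℝ :=
    fun n ω => √n * (RWP.profile q 1 h n (fun i => Ws i ω) θ).toReal with hY
  have hclt : TendstoInDistribution X atTop H (fun _ => μ) μ' :=
    RWP.tendstoInDistribution_multivariateGaussian
      (hindep.comp (fun _ v => h v θ) fun _ => hcont.measurable)
      (fun i => (hident i).comp hcont.measurable) hL2 hmean (fun _ _ => rfl) hH
  have hXmean : ∀ n ω, X n ω = √n • RWP.sampleMean n (fun i => Ws i ω) fun v => h v θ := by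
    intro n ω
    rw [hX, RWP.sampleMean, smul_smul, ← div_eq_mul_inv, Real.sqrt_div_self]
  have hSX : ∀ n ω, RWP.supLinear A (X n ω) =
      √n * RWP.supLinear A (-RWP.sampleMean n (fun i => Ws i ω) fun v => h v θ) := by
    intro n ω
    rw [hXmean, RWP.supLinear_smul_of_nonneg (Real.sqrt_nonneg _) hA hA0, hSneg]
  have hlower : ∀ n : ℕ, 1 ≤ n → ∀ ω, RWP.supLinear A (X n ω) ≤ Y n ω := by
    intro n hn ω
    rw [hSX]
    refine mul_le_mul_of_nonneg_left ?_ (Real.sqrt_nonneg _)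
    obtain ⟨ζ, hζ, hζx⟩ := (RWP.isGreatest_supLinear hA hA0
      (-RWP.sampleMean n (fun i => Ws i ω) fun v => h v θ)).1
    rw [← hζx]
    exact (ENNReal.ofReal_le_iff_le_toReal (hfin n hn _)).1
      (RWP.ofReal_inner_neg_mean_le_profile hn hcont hζ)
  -- Taking `ε = 1 / (k + 1)` keeps the exceptional null sets countable in number.
  have hupper : ∀ᵐ ω ∂μ, ∀ k : ℕ, ∀ᶠ n : ℕ in atTop,
      Y n ω ≤ RWP.supLinear A (X n ω) + ((k : ℝ) + 1)⁻¹ * ‖X n ω‖ := by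
    refine ae_all_iff.2 fun k => ?_
    have hk : 0 < ((k : ℝ) + 1)⁻¹ := by positivity
    filter_upwards [RWP.ae_eventually_profile_le hindep hident hcont hint hmean hA hk] with ω hω
    filter_upwards [hω] with n hn
    have hS0 : 0 ≤ RWP.supLinear A (-RWP.sampleMean n (fun i => Ws i ω) fun v => h v θ) := by
      simpa using RWP.inner_le_supLinear hA (RWP.zero_mem_lipSet (q := q)) _
    have h1 := ENNReal.toReal_mono ENNReal.ofReal_ne_top hn
    rw [ENNReal.toReal_ofReal (by positivity), norm_neg] at h1
    have h2 := mul_le_mul_of_nonneg_left h1 (Real.sqrt_nonneg n)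
    rw [hSX]
    rw [hXmean, norm_smul, Real.norm_of_nonneg (Real.sqrt_nonneg _)]
    linarith
  have hYmeas : ∀ n, AEMeasurable (Y n) μ := by
    intro n
    rcases Nat.eq_zero_or_pos n with rfl | hn
    · simp [hY]
    · have hWs : AEMeasurable (fun ω i => Ws i ω) μ :=
        aemeasurable_pi_lambda _ fun i => (hident i).aemeasurable_fst
      exact ((RWP.continuous_profile_toReal hn (hfin n hn)).measurable.comp_aemeasurable
        hWs).const_mul _
  have hXmeas : ∀ n, AEMeasurable (X n) μ := hclt.forall_aemeasurable
  have hSmeas := (RWP.continuous_supLinear hA).measurable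
  -- The error relative to `‖X n‖`: it tends to `0` almost surely, and `Y n = S(X n) + e n * ‖X n‖`
  -- is a continuous function of the pair `(X n, e n)`.
  set e : ℕ → Ω → ℝ := fun n ω => (Y n ω - RWP.supLinear A (X n ω)) / ‖X n ω‖ with he
  have hemeas : ∀ n, AEMeasurable (e n) μ := fun n =>
    ((hYmeas n).sub (hSmeas.comp_aemeasurable (hXmeas n))).div (hXmeas n).norm
  have hetend : ∀ᵐ ω ∂μ, Tendsto (fun n => e n ω) atTop (𝓝 0) := by
    filter_upwards [hupper] with ω hω
    rw [Metric.tendsto_nhds]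
    intro δ hδ
    obtain ⟨k, hk⟩ := exists_nat_one_div_lt hδ
    filter_upwards [hω k, eventually_ge_atTop 1] with n h1 h2
    have h3 : 0 ≤ e n ω := div_nonneg (sub_nonneg.2 (hlower n h2 ω)) (norm_nonneg _)
    have h4 : e n ω ≤ ((k : ℝ) + 1)⁻¹ :=
      div_le_of_le_mul₀ (norm_nonneg _) (by positivity) (by linarith)
    rw [Real.dist_eq, sub_zero, abs_of_nonneg h3]
    rw [one_div] at hk
    exact h4.trans_lt hk
  have heprob : TendstoInMeasure μ e atTop fun _ => (0 : ℝ) :=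
    tendstoInMeasure_of_tendsto_ae (fun n => (hemeas n).aestronglyMeasurable) hetend
  have hcontG : Continuous fun z : EuclideanSpace ℝ (Fin r) × ℝ =>
      RWP.supLinear A z.1 + z.2 * ‖z.1‖ :=
    ((RWP.continuous_supLinear hA).comp continuous_fst).add (by fun_prop)
  have hslutsky := hclt.continuous_comp_prodMk_of_tendstoInMeasure_const hcontG heprob hemeas
  refine hslutsky.congr (fun n => ae_of_all _ fun ω => ?_) (ae_of_all _ fun ω => by simp)
  -- If `X n ω = 0`, the quotient `e` carries no information, and `Y n ω = 0` is needed. For `n ≥ 1`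
  -- the empirical measure is itself feasible, so the empty family of moves suffices; for `n = 0`
  -- the factor `√n` vanishes.
  rcases eq_or_ne (X n ω) 0 with h0 | h0
  · have hS0 : RWP.supLinear A 0 = 0 := by
      simpa using RWP.supLinear_smul_of_nonneg le_rfl hA hA0 0
    simp only [h0, hS0, norm_zero, mul_zero, add_zero]
    rcases Nat.eq_zero_or_pos n with rfl | hn
    · simp [hY]
    · have hmean0 : RWP.sampleMean n (fun i => Ws i ω) (fun v => h v θ) = 0 := by
        rw [hXmean] at h0
        refine (smul_eq_zero.1 h0).resolve_left (Real.sqrt_ne_zero'.2 ?_)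
        exact_mod_cast hn
      have h1 := RWP.profile_le_of_moves (q := q) (h := h) (θ := θ) (w := fun i => Ws i ω) hn
        (J := Empty) (fun j => j.elim) (fun j => j.elim) (fun j => j.elim) (by simp)
        (by simp [hmean0])
      have h2 : RWP.profile q 1 h n (fun i => Ws i ω) θ = 0 := by simpa using h1
      simp [hY, h2]
  · simp only [he]
    rw [div_mul_cancel₀ _ (norm_ne_zero_iff.2 h0)]
    simp [hY]
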